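/- Let $(G(n),K(n))_{n\ge 1}$ be a sequence of Gelfand pairs: each $G(n)$ is a locally compact Hausdorff group, $K(n)$ is a compact subgroup of $G(n)$, and the convolution algebra of $K(n)$-biinvariant integrable functions on $G(n)$ is commutative. Suppose that $G(n)$ is (topologically) a closed subgroup of $G(n+1)$ and that $K(n)=K(n+1)\cap G(n)$ for every $n$. Let $\mathcal P^\natural(G(n))$ be the convex cone of $K(n)$-biinvariant continuous functions of positive type on $G(n)$, where $\varphi:G(n)\to\mathbb C$ is of positive type if $\sum_{i,j}c_i\overline{c_j}\,\varphi(g_j^{-1}g_i)\ge 0$ for all finite families $g_i\in G(n)$, $c_i\in\mathbb C$. Every convex cone $\Gamma$ carries its proper order, $x\ll y$ if and only if $y-x\in\Gamma$, and $\Gamma$ is called a lattice if any two of its elements have a greatest lower bound $x\wedge y$ and a least upper bound $x\vee y$ in $\Gamma$ for this order. Write $\mathrm{Res}_k^{m}$ for the restriction to $G(k)$ of functions on $G(m)$, $k\le m$. Let $\mathcal Q$ be the cone of subprojective systems, that is, of the families $\varphi=(\varphi^{(i)})_i\in\prod_{i\ge1}\mathcal P^\natural(G(i))$ such that $\mathrm{Res}_i^{i+1}\varphi^{(i+1)}\ll\varphi^{(i)}$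 for every $i$, and let $\mathcal P_\infty$ be the cone of projective systems, that is, of the families $\Phi=(\Phi^{(i)})_i\in\prod_{i\ge1}\mathcal P^\natural(G(i))$ such that $\mathrm{Res}_i^{i+1}\Phi^{(i+1)}=\Phi^{(i)}$ for every $i$. Then the cone $\mathcal Q$ is a lattice. Moreover, every $\varphi\in\mathcal Q$ has a unique decomposition $(\Phi,(\psi^{(k)})_k)$ with $\Phi\in\mathcal P_\infty$, $\psi^{(k)}\in\mathcal P^\natural(G(k))$ and $$\varphi^{(k)}=\Phi^{(k)}+\sum_{j=0}^\infty \mathrm{Res}_k^{k+j}\psi^{(k+j)}\quad\text{for every } k,$$ the series converging uniformly on $G(k)$. If $\varphi_1,\varphi_2\in\mathcal Q$ have the decompositions $(\Phi_1,(\psi_1^{(k)}))$ and $(\Phi_2,(\psi_2^{(k)}))$, then the infima $\Phi_1\wedge\Phi_2$ in $\mathcal P_\infty$ and $\psi_1^{(k)}\wedge\psi_2^{(k)}$ in $\mathcal P^\natural(G(k))$ exist and are the components of the decomposition of the infimum $\varphi_1\wedge\varphi_2$ in $\mathcal Q$; likewise, the suprema $\Phi_1\vee\Phi_2$ in $\mathcal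 P_\infty$ and $\psi_1^{(k)}\vee\psi_2^{(k)}$ in $\mathcal P^\natural(G(k))$ exist and are the components of the decomposition of the supremum $\varphi_1\vee\varphi_2$ in $\mathcal Q$. -/

import Mathlib

open MeasureTheory Filter Topology
open scoped ComplexOrder ComplexConjugate

namespace Olshanski

/-! ### Convex cones and their proper order -/

section Cones

variable {E : Type*} [AddCommGroup E] [Module ℝ E]

/-- The proper order of a convex cone: `x ≪ y` when `y - x` lies in the cone. -/
def ConeLE (C : PointedCone ℝ E) (x y : E) : Prop := y - x ∈ C

/-- `z` is a greatest lower bound of `x` and `y` in the cone `C`, for the proper order of `C`. -/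
def IsConeInf (C : PointedCone ℝ E) (x y z : E) : Prop :=
  z ∈ C ∧ ConeLE C z x ∧ ConeLE C z y ∧
    ∀ w ∈ C, ConeLE C w x → ConeLE C w y → ConeLE C w z

/-- `z` is a least upper bound of `x` and `y` in the cone `C`, for the proper order of `C`. -/
def IsConeSup (C : PointedCone ℝ E) (x y z : E) : Prop :=
  z ∈ C ∧ ConeLE C x z ∧ ConeLE C y z ∧
    ∀ w ∈ C, ConeLE C x w → ConeLE C y w → ConeLE C z w

/-- A cone is a lattice when any two of its elements have a greatest lower bound and a least
upper bound in it, for its proper order. -/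
def IsLatticeCone (C : PointedCone ℝ E) : Prop :=
  ∀ x ∈ C, ∀ y ∈ C, (∃ z, IsConeInf C x y z) ∧ (∃ z, IsConeSup C x y z)

end Cones

/-! ### Functions of positive type -/

section PositiveType

variable {G : Type*} [Group G]

/-- Functions of positive type. In the order of `ℂ`, `0 ≤ z` says that `z` is real and
nonnegative. -/
def IsPositiveType (φ : G → ℂ) : Prop :=
  ∀ (n : ℕ) (g : Fin n → G) (c : Fin n → ℂ),
    0 ≤ ∑ i, ∑ j, c i * conj (c j) * φ ((g j)⁻¹ * g i)

/-- `K`-biinvariant functions. -/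
def IsBiinvariant (K : Subgroup G) (φ : G → ℂ) : Prop :=
  ∀ k₁ ∈ K, ∀ k₂ ∈ K, ∀ g, φ (k₁ * g * k₂) = φ g

variable [TopologicalSpace G]

/-- The cone `P♮(G)` of the `K`-biinvariant continuous functions of positive type on `G`. -/
def posTypeCone (K : Subgroup G) : PointedCone ℝ (G → ℂ) where
  carrier := {φ | Continuous φ ∧ IsPositiveType φ ∧ IsBiinvariant K φ}
  zero_mem' := ⟨continuous_const, fun n g c => by simp, fun _ _ _ _ _ => rfl⟩
  add_mem' := by
    rintro φ ψ ⟨h1, h2, h3⟩ ⟨h1', h2', h3'⟩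
    refine ⟨h1.add h1', fun n g c => ?_, fun k₁ hk₁ k₂ hk₂ g => ?_⟩
    · have h := add_nonneg (h2 n g c) (h2' n g c)
      simpa only [Pi.add_apply, mul_add, Finset.sum_add_distrib] using h
    · simp only [Pi.add_apply, h3 k₁ hk₁ k₂ hk₂ g, h3' k₁ hk₁ k₂ hk₂ g]
  smul_mem' := by
    rintro r φ ⟨h1, h2, h3⟩
    refine ⟨h1.const_smul r, fun n g c => ?_, fun k₁ hk₁ k₂ hk₂ g => ?_⟩
    · have hr : (0 : ℂ) ≤ ((r : ℝ) : ℂ) := Complex.zero_le_real.2 r.2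
      have h := mul_nonneg hr (h2 n g c)
      have e : ∀ z : ℂ, r • z = ((r : ℝ) : ℂ) * z := fun z => Complex.real_smul
      simpa only [Pi.smul_apply, e, Finset.mul_sum, mul_left_comm] using h
    · simp only [Pi.smul_apply, h3 k₁ hk₁ k₂ hk₂ g]

end PositiveType

/-! ### Gelfand pairs -/

section Gelfand

variable {G : Type*} [Group G] [TopologicalSpace G] [IsTopologicalGroup G]
  [LocallyCompactSpace G] [MeasurableSpace G] [BorelSpace G]

/-- Convolution on a locally compact group, for a left Haar measure. -/
noncomputable def conv (f₁ f₂ : G → ℂ) (x : G) : ℂ :=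
  ∫ y, f₁ y * f₂ (y⁻¹ * x) ∂(Measure.haar : Measure G)

/-- Gelfand pairs: `K` is compact and the convolution algebra of the `K`-biinvariant integrable
functions is commutative. -/
def IsGelfandPair (K : Subgroup G) : Prop :=
  IsCompact (K : Set G) ∧
    ∀ f₁ f₂ : G → ℂ, Integrable f₁ (Measure.haar : Measure G) →
      Integrable f₂ (Measure.haar : Measure G) → IsBiinvariant K f₁ → IsBiinvariant K f₂ →
        conv f₁ f₂ =ᵐ[(Measure.haar : Measure G)] conv f₂ f₁

end Gelfand

/-! ### Subprojective and projective systems -/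

section Systems

variable {G : ℕ → Type*} [∀ n, Group (G n)]

/-- The embedding of `G k` into `G (k + j)` obtained by composing the embeddings `ι`. -/
def embed (ι : ∀ n, G n →* G (n + 1)) (k : ℕ) : ∀ j : ℕ, G k →* G (k + j)
  | 0 => MonoidHom.id (G k)
  | j + 1 => (ι (k + j)).comp (embed ι k j)

/-- The restriction to `G k` of a function on `G (k + j)`. -/
def res (ι : ∀ n, G n →* G (n + 1)) (k j : ℕ) (f : G (k + j) → ℂ) : G k → ℂ :=
  fun g => f (embed ι k j g)

variable [∀ n, TopologicalSpace (G n)]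

/-- The cone `Q` of subprojective systems: `φ n ∈ P♮(G n)` and the restriction of `φ (n + 1)` to
`G n` is `≪ φ n`, for every `n`. -/
def subprojCone (K : ∀ n, Subgroup (G n)) (ι : ∀ n, G n →* G (n + 1)) :
    PointedCone ℝ (∀ n, G n → ℂ) where
  carrier := {φ | (∀ n, φ n ∈ posTypeCone (K n)) ∧
    ∀ n, ConeLE (posTypeCone (K n)) (res ι n 1 (φ (n + 1))) (φ n)}
  zero_mem' := by
    refine ⟨fun n => zero_mem _, fun n => ?_⟩
    have e : (0 : G n → ℂ) - res ι n 1 (0 : G (n + 1) → ℂ) = 0 := by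
      funext g; simp [res]
    exact (congrArg (· ∈ posTypeCone (K n)) e).mpr (zero_mem _)
  add_mem' := by
    rintro φ ψ ⟨h1, h2⟩ ⟨h1', h2'⟩
    refine ⟨fun n => add_mem (h1 n) (h1' n), fun n => ?_⟩
    have e : (φ + ψ) n - res ι n 1 ((φ + ψ) (n + 1)) =
        (φ n - res ι n 1 (φ (n + 1))) + (ψ n - res ι n 1 (ψ (n + 1))) := by
      funext g; simp only [res, Pi.add_apply, Pi.sub_apply]; ring
    exact (congrArg (· ∈ posTypeCone (K n)) e).mpr (add_mem (h2 n) (h2' n))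
  smul_mem' := by
    rintro r φ ⟨h1, h2⟩
    refine ⟨fun n => Submodule.smul_mem _ r (h1 n), fun n => ?_⟩
    have e : (r • φ) n - res ι n 1 ((r • φ) (n + 1)) = r • (φ n - res ι n 1 (φ (n + 1))) := by
      funext g; simp only [res, Pi.smul_apply, Pi.sub_apply, smul_sub]
    exact (congrArg (· ∈ posTypeCone (K n)) e).mpr (Submodule.smul_mem _ r (h2 n))

/-- The cone of projective systems: `Φ n ∈ P♮(G n)` and the restriction of `Φ (n + 1)` to `G n`
is `Φ n`, for every `n`. These are the families of restrictions of the elements of `P♮(G)`, where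
`G` is the inductive limit of the groups `G n`. -/
def projCone (K : ∀ n, Subgroup (G n)) (ι : ∀ n, G n →* G (n + 1)) :
    PointedCone ℝ (∀ n, G n → ℂ) where
  carrier := {Φ | (∀ n, Φ n ∈ posTypeCone (K n)) ∧ ∀ n, res ι n 1 (Φ (n + 1)) = Φ n}
  zero_mem' := ⟨fun n => zero_mem _, fun n => rfl⟩
  add_mem' := by
    rintro φ ψ ⟨h1, h2⟩ ⟨h1', h2'⟩
    refine ⟨fun n => add_mem (h1 n) (h1' n), fun n => ?_⟩
    exact congrArg₂ (· + ·) (h2 n) (h2' n)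
  smul_mem' := by
    rintro r φ ⟨h1, h2⟩
    refine ⟨fun n => Submodule.smul_mem _ r (h1 n), fun n => ?_⟩
    exact congrArg (r • ·) (h2 n)

/-- `φ` decomposes into the projective system `Φ` and the functions `ψ k ∈ P♮(G k)`: for every
`k`, `φ k = Φ k + ∑_{j ≥ 0} res (ψ (k + j))`, the series converging uniformly on `G k`. -/
def IsDecomposition (K : ∀ n, Subgroup (G n)) (ι : ∀ n, G n →* G (n + 1))
    (φ Φ ψ : ∀ n, G n → ℂ) : Prop :=
  Φ ∈ projCone K ι ∧ (∀ k, ψ k ∈ posTypeCone (K k)) ∧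
    ∀ k, TendstoUniformly
      (fun (N : ℕ) (g : G k) => Φ k g + ∑ j ∈ Finset.range N, res ι k j (ψ (k + j)) g)
      (φ k) atTop

end Systems

end Olshanski

/-! The proof reduces to infima in each cone P♮(G n). In the GNS space of φ₁ + φ₂, the elements of
the cone dominated by φ₁ + φ₂ are matrix coefficients of positive operators commuting with the
translations (`exists_clm_of_le`, `translation_comm`), and conversely (`coeff_mem_posTypeCone`). For
a Gelfand pair such operators commute with one another
(`IsGelfandPair.commute_of_translation_comm`). Indeed, commutativity of convolution amounts to the
functional equation ∫ φ(akb) dk = ∫ φ(bka) dk for biinvariant φ. This makes the compressions P U_g P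
to the K-fixed vectors commute on the cyclic vector `e 1`, and operators commuting with those
compressions then commute on `e 1` too. Two commuting positive operators T₁, T₂ have the minimum T₁
- (T₁ - T₂)⁺, whose coefficient is the infimum.

For a subprojective system φ, the restrictions of φ (k + N) to G k decrease with N. An element of
the cone is bounded by its value at 1, so monotone bounded sequences converge uniformly. The limits
form Φ, the differences φ k - Res φ (k + 1) form ψ k, and the series telescopes. The decomposition
is unique and additive, so the order of Q is the product of the orders of the components
(`coneLE_of_isDecomposition`), and infima are taken componentwise; convergence of the new series
follows by domination (`IsDecomposition.exists_of_le`). Suprema come from x ∨ y = x + y - x ∧ y,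
valid in every cone that has all infima. -/

namespace Olshanski

open scoped InnerProductSpace

/-! ### The Hilbert space of a function of positive type. -/

section GNS

universe u

variable {G : Type u} [Group G]

lemma IsPositiveType.finsupp_nonneg {φ : G → ℂ} (hφ : IsPositiveType φ) (x : G →₀ ℂ) :
    0 ≤ x.sum fun a s => x.sum fun b t => conj s * t * φ (a⁻¹ * b) := by
  let q := x.support.equivFin.symm
  have h := hφ x.support.card (fun i => (q i : G)) (fun i => x (q i))
  have e : (∑ i, ∑ j, x (q i) * conj (x (q j)) * φ ((q j : G)⁻¹ * (q i : G))) =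
      x.sum fun a s => x.sum fun b t => conj s * t * φ (a⁻¹ * b) := by
    have key : ∀ f : G → ℂ, ∑ a ∈ x.support, f a = ∑ i, f (q i) := fun f =>
      ((q.sum_comp fun a => f a).trans (Finset.sum_coe_sort x.support f)).symm
    rw [Finset.sum_comm]
    simp only [Finsupp.sum, key]
    refine Finset.sum_congr rfl fun i _ => Finset.sum_congr rfl fun j _ => ?_
    ring
  rwa [e] at h

/-- Polarization on the points 1, g: coefficients (1, 1) give the imaginary parts, coefficients (1,
i) the real parts. -/
lemma IsPositiveType.inv_eq_conj {φ : G → ℂ} (hφ : IsPositiveType φ) (g : G) :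
    φ g⁻¹ = conj (φ g) := by
  have h0 := hφ 1 ![1] ![1]
  have h1 := hφ 2 ![1, g] ![1, 1]
  have h2 := hφ 2 ![1, g] ![1, Complex.I]
  simp only [Complex.le_def, Fin.sum_univ_two, Fin.sum_univ_one, Matrix.cons_val_zero, Matrix.cons_val_one, inv_one, one_mul, mul_one, map_one, inv_mul_cancel, Complex.conj_I, Complex.zero_im, Complex.add_im, Complex.mul_im, Complex.mul_re, Complex.neg_re, Complex.neg_im, Complex.I_re, Complex.I_im, Complex.add_re, Matrix.cons_val_fin_one] at h0 h1 h2
  apply Complex.ext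
  · simp only [Complex.conj_re]; linarith [h0.2, h1.2, h2.2]
  · simp only [Complex.conj_im]; linarith [h0.2, h1.2, h2.2]

/-- The pre-Hilbert structure on finitely supported functions given by a function of positive
type. -/
@[reducible]
noncomputable def IsPositiveType.preCore {φ : G → ℂ} (hφ : IsPositiveType φ) :
    PreInnerProductSpace.Core ℂ (G →₀ ℂ) where
  inner x y := x.sum fun a s => y.sum fun b t => conj s * t * φ (a⁻¹ * b)
  conj_inner_symm x y := by
    rw [Finsupp.sum_comm]
    simp only [map_finsuppSum]
    refine Finsupp.sum_congr fun a _ => Finsupp.sum_congr fun b _ => ?_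
    rw [map_mul, map_mul, ← hφ.inv_eq_conj]
    simp [mul_comm]
  re_inner_nonneg x := (Complex.le_def.1 (hφ.finsupp_nonneg x)).1
  add_left _ _ _ := by
    rw [Finsupp.sum_add_index'] <;> simp [← Finsupp.sum_add, add_mul]
  smul_left _ _ _ := by
    rw [Finsupp.sum_smul_index] <;> simp [Finsupp.mul_sum, ← mul_assoc]

/-- The Gelfand–Naimark–Segal construction for a function of positive type. -/
theorem IsPositiveType.exists_gns {φ : G → ℂ} (hφ : IsPositiveType φ) :
    ∃ (H : Type u) (_ : NormedAddCommGroup H) (_ : InnerProductSpace ℂ H) (_ : CompleteSpace H)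
      (e : G → H), DenseRange (Finsupp.linearCombination ℂ e) ∧
        ∀ g h, ⟪e g, e h⟫_ℂ = φ (g⁻¹ * h) := by
  -- The form may be degenerate; the completion also divides out the null vectors.
  let c : PreInnerProductSpace.Core ℂ (G →₀ ℂ) := hφ.preCore
  let i1 : SeminormedAddCommGroup (G →₀ ℂ) :=
    InnerProductSpace.Core.toSeminormedAddCommGroup (𝕜 := ℂ)
  let i2 : InnerProductSpace ℂ (G →₀ ℂ) := InnerProductSpace.ofCore c
  let L : (G →₀ ℂ) →L[ℂ] UniformSpace.Completion (G →₀ ℂ) := UniformSpace.Completion.toComplL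
  have hL : Finsupp.linearCombination ℂ (fun g => L (Finsupp.single g 1)) = L.toLinearMap := by
    ext g; simp
  refine ⟨UniformSpace.Completion (G →₀ ℂ), inferInstance, inferInstance, inferInstance,
    fun g => L (Finsupp.single g 1), ?_, fun g h => ?_⟩
  · rw [hL]; exact UniformSpace.Completion.denseRange_coe
  · change ⟪((Finsupp.single g 1 : G →₀ ℂ) : UniformSpace.Completion (G →₀ ℂ)),
      ((Finsupp.single h 1 : G →₀ ℂ) : UniformSpace.Completion (G →₀ ℂ))⟫_ℂ = _
    rw [UniformSpace.Completion.inner_coe]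
    change Finsupp.sum _ _ = _
    simp

end GNS

/-! ### Vectors and operators determined on a total family. -/

section Total

variable {G : Type*} {H : Type*} [NormedAddCommGroup H] [InnerProductSpace ℂ H]
  {H' : Type*} [NormedAddCommGroup H'] [InnerProductSpace ℂ H']

lemma inner_linearCombination (e e' : G → H) (x : G →₀ ℂ) :
    ⟪Finsupp.linearCombination ℂ e x, Finsupp.linearCombination ℂ e' x⟫_ℂ =
      x.sum fun a s => x.sum fun b t => conj s * t * ⟪e a, e' b⟫_ℂ := by
  simp only [Finsupp.linearCombination_apply, Finsupp.sum, sum_inner, inner_sum,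
    inner_smul_left, inner_smul_right, Finset.mul_sum]
  rw [Finset.sum_comm]
  refine Finset.sum_congr rfl fun a _ => Finset.sum_congr rfl fun b _ => ?_
  ring

lemma eq_of_inner_total {e : G → H} (he : DenseRange (Finsupp.linearCombination ℂ e)) {x y : H}
    (h : ∀ g, ⟪e g, x⟫_ℂ = ⟪e g, y⟫_ℂ) : x = y := by
  refine he.eq_of_inner_right ℂ fun c => ?_
  simp only [Finsupp.linearCombination_apply, Finsupp.sum_inner, inner_smul_left, h]

lemma clm_ext_total {e : G → H} (he : DenseRange (Finsupp.linearCombination ℂ e))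
    {S T : H →L[ℂ] H'} (h : ∀ g, S (e g) = T (e g)) : S = T := by
  refine ContinuousLinearMap.coeFn_injective (he.equalizer S.continuous T.continuous ?_)
  funext c
  simp [Finsupp.linearCombination_apply, map_finsuppSum, h]

/-- The norm inequality carries every linear relation among the `e g` over to the `e' g`, so the
assignment is well defined and contractive on a dense subspace. -/
lemma exists_clm_of_total [CompleteSpace H'] {e : G → H}
    (he : DenseRange (Finsupp.linearCombination ℂ e)) {e' : G → H'}
    (h : ∀ x, ‖Finsupp.linearCombination ℂ e' x‖ ≤ ‖Finsupp.linearCombination ℂ e x‖) :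
    ∃ V : H →L[ℂ] H', ∀ g, V (e g) = e' g := by
  refine ⟨(Finsupp.linearCombination ℂ e').extendOfNorm (Finsupp.linearCombination ℂ e),
    fun g => ?_⟩
  have := LinearMap.extendOfNorm_eq he (f := Finsupp.linearCombination ℂ e')
    ⟨1, fun x => by simpa using h x⟩ (Finsupp.single g 1)
  simpa using this

variable [Group G]

/-- An operator whose matrix coefficients come from a function of positive type is positive. -/
lemma nonneg_of_positiveType [CompleteSpace H] {e : G → H}
    (he : DenseRange (Finsupp.linearCombination ℂ e)) {ψ : G → ℂ} (hψ : IsPositiveType ψ)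
    {T : H →L[ℂ] H} (hT : ∀ g h, ⟪e g, T (e h)⟫_ℂ = ψ (g⁻¹ * h)) : 0 ≤ T := by
  rw [ContinuousLinearMap.nonneg_iff_isPositive, ContinuousLinearMap.isPositive_iff_complex]
  suffices h : ∀ x, 0 ≤ ⟪x, T x⟫_ℂ by
    intro x
    have h1 := Complex.le_def.1 (h x)
    simp only [Complex.zero_re, Complex.zero_im] at h1
    rw [← inner_conj_symm, RCLike.re_to_complex, Complex.conj_re]
    exact ⟨Complex.ext (by rw [Complex.ofReal_re, Complex.conj_re])
      (by rw [Complex.ofReal_im, Complex.conj_im, ← h1.2, neg_zero]), h1.1⟩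
  intro x
  refine he.induction_on (p := fun x => 0 ≤ ⟪x, T x⟫_ℂ) x
    (isClosed_le continuous_const (by fun_prop)) fun c => ?_
  have h2 : T (Finsupp.linearCombination ℂ e c) =
      Finsupp.linearCombination ℂ (fun g => T (e g)) c := by
    simp [Finsupp.linearCombination_apply, map_finsuppSum]
  rw [h2, inner_linearCombination]
  simpa only [hT] using hψ.finsupp_nonneg c

/-- Conversely, positive operators give functions of positive type. -/
lemma positiveType_of_nonneg [CompleteSpace H] {e : G → H} {ψ : G → ℂ} {T : H →L[ℂ] H}
    (hT : ∀ g h, ⟪e g, T (e h)⟫_ℂ = ψ (g⁻¹ * h)) (h0 : 0 ≤ T) : IsPositiveType ψ := by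
  intro n g c
  have h1 : 0 ≤ ⟪∑ i, c i • e (g i), T (∑ i, c i • e (g i))⟫_ℂ :=
    ((ContinuousLinearMap.nonneg_iff_isPositive T).1 h0).inner_nonneg_right _
  convert h1 using 1
  simp only [map_sum, sum_inner, inner_sum, map_smul, inner_smul_left, inner_smul_right, hT]
  simp only [Finset.mul_sum]
  refine Finset.sum_congr rfl fun i _ => Finset.sum_congr rfl fun j _ => ?_
  ring

end Total

/-! ### Commutativity of the commutant on a cyclic vector. -/

section Abelian

variable {H : Type*} [NormedAddCommGroup H] [InnerProductSpace ℂ H] [CompleteSpace H]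

open ContinuousLinearMap in
/-- If a self-adjoint space of operators is commutative on `v`, then its commutant is commutative
on `v`, as seen from the cyclic subspace of `v`. -/
lemma inner_commutant_comm (A : Submodule ℂ (H →L[ℂ] H)) {v : H}
    (hadj : ∀ a ∈ A, adjoint a ∈ A) (hcomm : ∀ a ∈ A, ∀ b ∈ A, a (b v) = b (a v))
    {S T : H →L[ℂ] H} (hS : ∀ a ∈ A, ∀ x, S (a x) = a (S x)) (hT : ∀ a ∈ A, ∀ x, T (a x) = a (T x))
    (hTsa : adjoint T = T) (hTv : T v ∈ closure ((fun a : H →L[ℂ] H => a v) '' A))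
    {b : H →L[ℂ] H} (hb : b ∈ A) : ⟪b v, S (T v)⟫_ℂ = ⟪b v, T (S v)⟫_ℂ := by
  obtain ⟨s, hs, hlim⟩ := mem_closure_iff_seq_limit.1 hTv
  choose a ha has using hs
  have hsa : s = fun n => a n v := funext fun n => (has n).symm
  subst hsa
  have hTi : ∀ x y, ⟪T x, y⟫_ℂ = ⟪x, T y⟫_ℂ := fun x y => by
    conv_lhs => rw [← hTsa, adjoint_inner_left]
  -- Each `a n` behaves on `v` like a normal operator, and `T` is self-adjoint and commutes with it.
  -- Hence the adjoints applied to `v` approximate `T v` as well.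
  have hnorm : ∀ n, ‖adjoint (a n) v - T v‖ = ‖a n v - T v‖ := fun n => by
    have h1 := hcomm _ (ha n) _ (hadj _ (ha n))
    have key : ⟪adjoint (a n) v - T v, adjoint (a n) v - T v⟫_ℂ =
        ⟪a n v - T v, a n v - T v⟫_ℂ := by
      simp only [inner_sub_left, inner_sub_right, adjoint_inner_left, hTi,
        ← adjoint_inner_right (a n)]
      rw [h1, hT _ (ha n), hT _ (hadj _ (ha n))]
      ring
    rw [@norm_eq_sqrt_re_inner ℂ, @norm_eq_sqrt_re_inner ℂ, key]
  have hlim' : Tendsto (fun n => adjoint (a n) v) atTop (𝓝 (T v)) := by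
    rw [tendsto_iff_norm_sub_tendsto_zero] at hlim ⊢
    simpa only [hnorm] using hlim
  have l1 : Tendsto (fun n => ⟪b v, S (a n v)⟫_ℂ) atTop (𝓝 ⟪b v, S (T v)⟫_ℂ) :=
    tendsto_const_nhds.inner ((S.continuous.tendsto _).comp hlim)
  have l2 : Tendsto (fun n => ⟪b (adjoint (a n) v), S v⟫_ℂ) atTop (𝓝 ⟪b (T v), S v⟫_ℂ) :=
    ((b.continuous.tendsto _).comp hlim').inner tendsto_const_nhds
  -- Move `a n` past `S`, pass to its adjoint, and commute that with `b` on `v`; the limit replaces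
  -- `a n` by `T` on both sides.
  have e : (fun n => ⟪b v, S (a n v)⟫_ℂ) = fun n => ⟪b (adjoint (a n) v), S v⟫_ℂ := by
    funext n
    rw [hS _ (ha n), ← hcomm _ (hadj _ (ha n)) _ hb, adjoint_inner_left]
  rw [e] at l1
  rw [tendsto_nhds_unique l1 l2, ← hT _ hb, hTi]

end Abelian

/-! ### Minima of commuting self-adjoint elements. -/

section CStar

variable {A : Type*} [CStarAlgebra A] [PartialOrder A] [StarOrderedRing A]

/-- Commuting minima: if `x + a⁺` and `x + a⁻` are nonnegative and `x` commutes with `a`, then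
`x` is nonnegative. -/
lemma nonneg_of_add_posPart_of_add_negPart {x a : A} (hx : IsSelfAdjoint x)
    (hxa : Commute x a) (h1 : 0 ≤ x + a⁺) (h2 : 0 ≤ x + a⁻) : 0 ≤ x := by
  have c1 : Commute x⁻ a := by
    rw [CFC.negPart_def]; exact hxa.cfcₙ_real _
  have cp : Commute x⁻ a⁺ := by
    rw [CFC.posPart_def]; exact (c1.symm.cfcₙ_real _).symm
  have cn : Commute x⁻ a⁻ := by
    rw [CFC.negPart_def a]; exact (c1.symm.cfcₙ_real _).symm
  have cx : Commute x⁻ x := by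
    rw [CFC.negPart_def]; exact (Commute.refl x).cfcₙ_real _
  have hn : 0 ≤ x⁻ := CFC.negPart_nonneg x
  have hxn : x⁻ * x = -(x⁻ * x⁻) := by
    have h : x⁺ - x⁻ = x := CFC.posPart_sub_negPart x hx
    calc x⁻ * x = x⁻ * (x⁺ - x⁻) := by rw [h]
      _ = _ := by rw [mul_sub, CFC.negPart_mul_posPart, zero_sub]
  -- Since a⁺a⁻ = 0, multiplying the first inequality by x⁻ and a⁻ leaves -(x⁻)²a⁻ ≥ 0, so (x⁻)²a⁻ =
  -- 0. Multiplying the second by (x⁻)² then leaves -(x⁻)³ ≥ 0, so x⁻ is nilpotent, hence zero.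
  have e1 : x⁻ * (x + a⁺) = x⁻ * a⁺ - x⁻ * x⁻ := by rw [mul_add, hxn]; abel
  have e2 : x⁻ * (x + a⁻) = x⁻ * a⁻ - x⁻ * x⁻ := by rw [mul_add, hxn]; abel
  have p1 : 0 ≤ x⁻ * a⁺ - x⁻ * x⁻ := e1 ▸ (cx.add_right cp).mul_nonneg hn h1
  have p2 : 0 ≤ x⁻ * a⁻ - x⁻ * x⁻ := e2 ▸ (cx.add_right cn).mul_nonneg hn h2
  have hsq : 0 ≤ x⁻ * x⁻ := (Commute.refl _).mul_nonneg hn hn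
  have cpn : Commute a⁺ a⁻ := by
    simp [Commute, SemiconjBy, CFC.posPart_mul_negPart, CFC.negPart_mul_posPart]
  have q1 : 0 ≤ (x⁻ * a⁺ - x⁻ * x⁻) * a⁻ :=
    ((cn.mul_left cpn).sub_left (cn.mul_left cn)).mul_nonneg p1 (CFC.negPart_nonneg a)
  have q2 : x⁻ * x⁻ * a⁻ = 0 := by
    refine le_antisymm ?_ ((cn.mul_left cn).mul_nonneg hsq (CFC.negPart_nonneg a))
    rw [sub_mul, mul_assoc, CFC.posPart_mul_negPart, mul_zero, zero_sub] at q1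
    exact neg_nonneg.1 q1
  have q3 : 0 ≤ x⁻ * (x⁻ * a⁻ - x⁻ * x⁻) :=
    (((Commute.refl _).mul_right cn).sub_right
      ((Commute.refl _).mul_right (Commute.refl _))).mul_nonneg hn p2
  have q4 : x⁻ * (x⁻ * x⁻) = 0 := by
    refine le_antisymm ?_ (((Commute.refl _).mul_right (Commute.refl _)).mul_nonneg hn hsq)
    rw [mul_sub, ← mul_assoc, q2, zero_sub] at q3
    exact neg_nonneg.1 q3
  have hsa : star x⁻ = x⁻ := (IsSelfAdjoint.of_nonneg hn).star_eq
  have q5 : x⁻ * x⁻ = 0 := by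
    rw [← CStarRing.star_mul_self_eq_zero_iff, star_mul, hsa, mul_assoc, q4, mul_zero]
  have q6 : x⁻ = 0 := by
    rw [← CStarRing.star_mul_self_eq_zero_iff, hsa, q5]
  exact (CFC.negPart_eq_zero_iff x hx).1 q6

end CStar

/-! ### Parametric integrals and Haar probability measures. -/

section CompactSupport

lemma continuous_integral_of_forall_notMem {X Y E : Type*} [TopologicalSpace X] [TopologicalSpace Y]
    [MeasurableSpace Y] [OpensMeasurableSpace Y] [NormedAddCommGroup E] [NormedSpace ℝ E]
    {ν : Measure Y} [IsFiniteMeasureOnCompacts ν] {f : X → Y → E} (hf : Continuous f.uncurry)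
    {k : Set Y} (hk : IsCompact k) (hfk : ∀ x y, y ∉ k → f x y = 0) :
    Continuous fun x => ∫ y, f x y ∂ν := by
  rw [← continuousOn_univ]
  exact continuousOn_integral_of_compact_support hk hf.continuousOn fun p x _ => hfk p x

/-- Conjugation carries `μ` to another Haar probability measure, hence to `μ`; right translation is
conjugation followed by left translation. -/
lemma isMulRightInvariant_of_isProbabilityMeasure {K : Type*} [Group K] [TopologicalSpace K]
    [IsTopologicalGroup K] [LocallyCompactSpace K] [MeasurableSpace K] [BorelSpace K]
    (μ : Measure K) [μ.IsHaarMeasure] [IsProbabilityMeasure μ] : μ.IsMulRightInvariant := by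
  refine ⟨fun g => ?_⟩
  have hm : Continuous (MulAut.conj g⁻¹ : K ≃* K) := by
    change Continuous fun x => g⁻¹ * x * g⁻¹⁻¹
    fun_prop
  have hm' : Continuous (MulAut.conj g⁻¹ : K ≃* K).symm := by
    change Continuous fun x => g⁻¹⁻¹ * x * g⁻¹
    fun_prop
  have := (MulAut.conj g⁻¹ : K ≃* K).isHaarMeasure_map (μ := μ) hm hm'
  have := Measure.isProbabilityMeasure_map (μ := μ) hm.aemeasurable
  have h1 : μ.map (MulAut.conj g⁻¹ : K ≃* K) = μ :=
    Measure.isHaarMeasure_eq_of_isProbabilityMeasure _ _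
  calc μ.map (· * g) = (μ.map (MulAut.conj g⁻¹ : K ≃* K)).map (g * ·) := by
        rw [Measure.map_map (by fun_prop) hm.measurable]
        congr 1; funext x; simp [mul_assoc]
    _ = μ := by rw [h1, map_mul_left_eq_self]

end CompactSupport

/-! ### Biinvariant test functions and the functional equation of a Gelfand pair. -/

section Test

variable {G : Type*} [Group G] [TopologicalSpace G] [IsTopologicalGroup G]
  [LocallyCompactSpace G]

/-- Bi-invariant test functions concentrated around a double coset. -/
lemma exists_biinvariant_bump {K : Subgroup G} (hK : IsCompact (K : Set G)) {a : G} {V : Set G}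
    (hV : IsOpen V) (ha : a ∈ V) :
    ∃ f : G → ℝ, Continuous f ∧ HasCompactSupport f ∧ (∀ y, 0 ≤ f y) ∧ f a ≠ 0 ∧
      (∀ k₁ ∈ K, ∀ k₂ ∈ K, ∀ g, f (k₁ * g * k₂) = f g) ∧
      ∀ y, f y ≠ 0 → ∃ k₁ ∈ K, ∃ k₂ ∈ K, k₁ * y * k₂ ∈ V := by
  obtain ⟨u, hu1, hu0, huc, hu⟩ := exists_continuous_one_zero_of_isCompact
    (isCompact_singleton (x := a)) hV.isClosed_compl (by simpa using ha)
  have hKK : IsCompact ((K : Set G) ×ˢ (K : Set G)) := hK.prod hK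
  have hne : ((K : Set G) ×ˢ (K : Set G)).Nonempty := ⟨(1, 1), K.one_mem, K.one_mem⟩
  have hcont : ∀ y, ContinuousOn (fun p : G × G => u (p.1 * y * p.2)) ((K : Set G) ×ˢ (K : Set G)) :=
    fun y => by fun_prop
  have hatt : ∀ y, ∃ k₁ ∈ K, ∃ k₂ ∈ K,
      sSup ((fun p : G × G => u (p.1 * y * p.2)) '' ((K : Set G) ×ˢ (K : Set G))) =
        u (k₁ * y * k₂) := fun y => by
    obtain ⟨p, hp, h⟩ := hKK.exists_sSup_image_eq hne (hcont y)
    exact ⟨p.1, hp.1, p.2, hp.2, h⟩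
  -- The supremum of a bump function over K y K is biinvariant; being attained, it is nonzero only
  -- where K y K meets `V`.
  refine ⟨fun y => sSup ((fun p : G × G => u (p.1 * y * p.2)) '' ((K : Set G) ×ˢ (K : Set G))),
    ?_, ?_, fun y => ?_, ?_, fun k₁ hk₁ k₂ hk₂ g => ?_, fun y hy => ?_⟩
  · refine hKK.continuous_sSup (f := fun y (p : G × G) => u (p.1 * y * p.2)) ?_
    change Continuous fun q : G × G × G => u (q.2.1 * q.1 * q.2.2)
    fun_prop
  · have hc : IsCompact ((fun q : G × G × G => q.1⁻¹ * q.2.1 * q.2.2⁻¹) ''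
        ((K : Set G) ×ˢ (tsupport u ×ˢ (K : Set G)))) :=
      (hK.prod (huc.isCompact.prod hK)).image (by fun_prop)
    refine HasCompactSupport.intro hc fun y hy => ?_
    obtain ⟨k₁, hk₁, k₂, hk₂, h⟩ := hatt y
    rw [h]
    by_contra hne
    exact hy ⟨(k₁, k₁ * y * k₂, k₂), ⟨hk₁, subset_tsupport _ hne, hk₂⟩, by
      simp [mul_assoc]⟩
  · obtain ⟨k₁, -, k₂, -, h⟩ := hatt y
    simpa only [h] using (hu _).1
  · have h1 : u a ≤ sSup ((fun p : G × G => u (p.1 * a * p.2)) '' ((K : Set G) ×ˢ (K : Set G))) :=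
      le_csSup (hKK.bddAbove_image (hcont a)) ⟨(1, 1), ⟨K.one_mem, K.one_mem⟩, by simp⟩
    rw [hu1 rfl] at h1
    exact (lt_of_lt_of_le one_pos h1).ne'
  · refine congrArg sSup (Set.ext fun r => ⟨?_, ?_⟩)
    · rintro ⟨p, hp, rfl⟩
      exact ⟨(p.1 * k₁, k₂ * p.2), ⟨K.mul_mem hp.1 hk₁, K.mul_mem hk₂ hp.2⟩, by
        simp only [mul_assoc]⟩
    · rintro ⟨p, hp, rfl⟩
      exact ⟨(p.1 * k₁⁻¹, k₂⁻¹ * p.2),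
        ⟨K.mul_mem hp.1 (K.inv_mem hk₁), K.mul_mem (K.inv_mem hk₂) hp.2⟩, by
        simp only [mul_assoc, inv_mul_cancel_left, mul_inv_cancel_left]⟩
  · obtain ⟨k₁, hk₁, k₂, hk₂, h⟩ := hatt y
    refine ⟨k₁, hk₁, k₂, hk₂, ?_⟩
    by_contra hn
    exact hy (h.trans (hu0 hn))

variable [MeasurableSpace G] [BorelSpace G]

/-- A continuous function which is bi-invariant in both variables and orthogonal to all products
of bi-invariant test functions vanishes. -/
lemma eq_zero_of_integral_biinvariant {K : Subgroup G} (hK : IsCompact (K : Set G))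
    (ν : Measure G) [IsFiniteMeasureOnCompacts ν] [ν.IsOpenPosMeasure] {F : G → G → ℂ}
    (hF : Continuous F.uncurry)
    (hF1 : ∀ k₁ ∈ K, ∀ k₂ ∈ K, ∀ y z, F (k₁ * y * k₂) z = F y z)
    (hF2 : ∀ k₁ ∈ K, ∀ k₂ ∈ K, ∀ y z, F y (k₁ * z * k₂) = F y z)
    (h : ∀ f g : G → ℝ, Continuous f → Continuous g → HasCompactSupport f → HasCompactSupport g →
      (∀ k₁ ∈ K, ∀ k₂ ∈ K, ∀ x, f (k₁ * x * k₂) = f x) →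
      (∀ k₁ ∈ K, ∀ k₂ ∈ K, ∀ x, g (k₁ * x * k₂) = g x) →
      ∫ y, ∫ z, ((f y : ℂ) * g z) * F y z ∂ν ∂ν = 0) (a b : G) : F a b = 0 := by
  by_contra hab
  -- The real part after rotation by the conjugate of F a b: positive at (a, b), hence on a
  -- neighbourhood, and by biinvariance wherever the test functions are nonzero.
  let R : ℂ →L[ℝ] ℝ := Complex.reCLM.comp (ContinuousLinearMap.mul ℝ ℂ (conj (F a b)))
  have hR : ∀ (r : ℝ) (z : ℂ), R (r * z) = r * R z := fun r z => by
    simp [R, mul_left_comm _ (r : ℂ)]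
  have hRab : 0 < R (F a b) := by
    have : R (F a b) = Complex.normSq (F a b) := by
      simp [R, Complex.normSq_apply]
    rw [this]; exact Complex.normSq_pos.2 hab
  have hopen : IsOpen {p : G × G | 0 < R (F p.1 p.2)} :=
    isOpen_lt continuous_const (R.continuous.comp hF)
  obtain ⟨V, W, hV, hW, haV, hbW, hVW⟩ := isOpen_prod_iff.1 hopen a b hRab
  obtain ⟨f, fc, fs, f0, fa, fK, fV⟩ := exists_biinvariant_bump hK hV haV
  obtain ⟨g, gc, gs, g0, gb, gK, gW⟩ := exists_biinvariant_bump hK hW hbW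
  have hpos : ∀ y z, f y ≠ 0 → g z ≠ 0 → 0 < R (F y z) := fun y z hy hz => by
    obtain ⟨k₁, hk₁, k₂, hk₂, h1⟩ := fV y hy
    obtain ⟨l₁, hl₁, l₂, hl₂, h2⟩ := gW z hz
    have h3 : 0 < R (F (k₁ * y * k₂) (l₁ * z * l₂)) := hVW (Set.mk_mem_prod h1 h2)
    rwa [hF1 _ hk₁ _ hk₂, hF2 _ hl₁ _ hl₂] at h3
  have hnn : ∀ y z, 0 ≤ f y * g z * R (F y z) := fun y z => by
    by_cases hy : f y = 0
    · simp [hy]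
    by_cases hz : g z = 0
    · simp [hz]
    exact mul_nonneg (mul_nonneg (f0 y) (g0 z)) (hpos y z hy hz).le
  have hFc : Continuous fun p : G × G => F p.1 p.2 := hF
  have hgz : ∀ z, z ∉ tsupport g → g z = 0 := fun z hz => image_eq_zero_of_notMem_tsupport hz
  have hfz : ∀ z, z ∉ tsupport f → f z = 0 := fun z hz => image_eq_zero_of_notMem_tsupport hz
  have cin : ∀ y, Continuous fun z => F y z := fun y =>
    hFc.comp (Continuous.prodMk continuous_const continuous_id)
  have i1 : ∀ y, Integrable (fun z => ((f y : ℂ) * g z) * F y z) ν := fun y => by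
    refine Continuous.integrable_of_hasCompactSupport ?_ ?_
    · have := cin y; fun_prop
    · exact HasCompactSupport.intro gs.isCompact fun z hz => by simp [hgz z hz]
  have c2 : Continuous fun y => ∫ z, ((f y : ℂ) * g z) * F y z ∂ν := by
    refine continuous_integral_of_forall_notMem ?_ gs.isCompact fun y z hz => by simp [hgz z hz]
    change Continuous fun p : G × G => ((f p.1 : ℂ) * g p.2) * F p.1 p.2
    fun_prop
  have i2 : Integrable (fun y => ∫ z, ((f y : ℂ) * g z) * F y z ∂ν) ν :=
    c2.integrable_of_hasCompactSupport
      (HasCompactSupport.intro fs.isCompact fun z hz => by simp [hfz z hz])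
  have e1 : ∀ y, R (∫ z, ((f y : ℂ) * g z) * F y z ∂ν) = ∫ z, f y * g z * R (F y z) ∂ν := fun y => by
    rw [← R.integral_comp_comm (i1 y)]
    refine integral_congr_ae (Eventually.of_forall fun z => ?_)
    simp only [← Complex.ofReal_mul, hR]
  have e2 : R (∫ y, ∫ z, ((f y : ℂ) * g z) * F y z ∂ν ∂ν) =
      ∫ y, ∫ z, f y * g z * R (F y z) ∂ν ∂ν := by
    rw [← R.integral_comp_comm i2]
    simp only [e1]
  rw [h f g fc gc fs gs fK gK, map_zero] at e2
  have hin : 0 < ∫ z, f a * g z * R (F a z) ∂ν := by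
    refine Continuous.integral_pos_of_hasCompactSupport_nonneg_nonzero (x := b) ?_ ?_
      (fun z => hnn a z) ?_
    · have := cin a; fun_prop
    · exact HasCompactSupport.intro gs.isCompact fun z hz => by simp [hgz z hz]
    · exact mul_ne_zero (mul_ne_zero fa gb) (hpos a b fa gb).ne'
  refine e2.not_lt ?_
  refine Continuous.integral_pos_of_hasCompactSupport_nonneg_nonzero (μ := ν) (x := a) ?_ ?_
    (fun y => integral_nonneg (hnn y)) hin.ne'
  · simp only [← e1]
    exact R.continuous.comp c2
  · exact HasCompactSupport.intro fs.isCompact fun z hz => by simp [hfz z hz]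

/-- Integrating a convolution against a continuous function. -/
lemma integral_conv_mul {f g φ : G → ℂ} (hf : Continuous f) (hg : Continuous g)
    (fs : HasCompactSupport f) (gs : HasCompactSupport g) (hφ : Continuous φ) :
    ∫ x, conv f g x * φ x ∂(Measure.haar : Measure G) =
      ∫ y, ∫ z, f y * g z * φ (y * z) ∂(Measure.haar : Measure G) ∂(Measure.haar : Measure G) := by
  have h1 : ∀ x, conv f g x * φ x =
      ∫ y, f y * g (y⁻¹ * x) * φ x ∂(Measure.haar : Measure G) := fun x =>
    (integral_mul_const _ _).symm
  simp only [h1]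
  -- After Fubini, the substitution x = y z uses left invariance.
  rw [integral_integral_swap_of_hasCompactSupport]
  · refine integral_congr_ae (Eventually.of_forall fun y => ?_)
    simpa using (integral_mul_left_eq_self (μ := (Measure.haar : Measure G))
      (fun x => f y * g (y⁻¹ * x) * φ x) y).symm
  · change Continuous fun p : G × G => f p.2 * g (p.2⁻¹ * p.1) * φ p.1
    fun_prop
  · have hc : IsCompact ((fun q : G × G => (q.1 * q.2, q.1)) '' (tsupport f ×ˢ tsupport g)) :=
      (fs.isCompact.prod gs.isCompact).image (by fun_prop)
    refine HasCompactSupport.intro hc fun p hp => ?_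
    change f p.2 * g (p.2⁻¹ * p.1) * φ p.1 = 0
    by_contra hne
    refine hp ⟨(p.2, p.2⁻¹ * p.1), ⟨subset_tsupport _ ?_, subset_tsupport _ ?_⟩, by simp⟩
    · intro h0; exact hne (by simp [h0])
    · intro h0; exact hne (by simp [h0])

/-- The functional equation expressing the commutativity of the algebra of bi-invariant
functions. -/
theorem IsGelfandPair.integral_comm {K : Subgroup G} (hK : IsGelfandPair K) [CompactSpace K]
    (μ : Measure K) [μ.IsHaarMeasure] [IsProbabilityMeasure μ] {φ : G → ℂ} (hφ : Continuous φ)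
    (hφK : IsBiinvariant K φ) (a b : G) : ∫ k : K, φ (a * k * b) ∂μ = ∫ k : K, φ (b * k * a) ∂μ := by
  have hr := isMulRightInvariant_of_isProbabilityMeasure μ
  let ν : Measure G := Measure.haar
  have hL : ∀ k ∈ K, ∀ x, φ (k * x) = φ x := fun k hk x => by
    simpa using hφK k hk 1 K.one_mem x
  have hR : ∀ k ∈ K, ∀ x, φ (x * k) = φ x := fun k hk x => by
    simpa using hφK 1 K.one_mem k hk x
  have cF : Continuous (Function.uncurry fun (p : G × G) (k : K) => φ (p.1 * k * p.2)) := by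
    change Continuous fun q : (G × G) × K => φ (q.1.1 * q.2 * q.1.2)
    fun_prop
  have cI : Continuous fun p : G × G => ∫ k : K, φ (p.1 * k * p.2) ∂μ :=
    continuous_integral_of_forall_notMem cF isCompact_univ fun _ y hy => absurd (Set.mem_univ y) hy
  have inv1 : ∀ k₁ ∈ K, ∀ k₂ ∈ K, ∀ y z,
      ∫ k : K, φ ((k₁ * y * k₂) * k * z) ∂μ = ∫ k : K, φ (y * k * z) ∂μ := fun k₁ h₁ k₂ h₂ y z => by
    rw [← integral_mul_left_eq_self (μ := μ) (fun k : K => φ (y * k * z)) ⟨k₂, h₂⟩]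
    refine integral_congr_ae (Eventually.of_forall fun k => ?_)
    simp only [Subgroup.coe_mul, mul_assoc, hL k₁ h₁]
  have inv2 : ∀ k₁ ∈ K, ∀ k₂ ∈ K, ∀ y z,
      ∫ k : K, φ (y * k * (k₁ * z * k₂)) ∂μ = ∫ k : K, φ (y * k * z) ∂μ := fun k₁ h₁ k₂ h₂ y z => by
    rw [← integral_mul_right_eq_self (μ := μ) (fun k : K => φ (y * k * z)) ⟨k₁, h₁⟩]
    refine integral_congr_ae (Eventually.of_forall fun k => ?_)
    simp only [Subgroup.coe_mul, ← mul_assoc, hR k₂ h₂]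
  have swap : Continuous fun p : G × G => ∫ k : K, φ (p.2 * k * p.1) ∂μ :=
    cI.comp continuous_swap
  refine sub_eq_zero.1 (eq_zero_of_integral_biinvariant hK.1 ν
    (F := fun y z => ∫ k : K, φ (y * k * z) ∂μ - ∫ k : K, φ (z * k * y) ∂μ) (cI.sub swap)
    (fun k₁ h₁ k₂ h₂ y z => by rw [inv1 _ h₁ _ h₂, inv2 _ h₁ _ h₂])
    (fun k₁ h₁ k₂ h₂ y z => by rw [inv1 _ h₁ _ h₂, inv2 _ h₁ _ h₂]) ?_ a b)
  intro f g fc gc fs gs fK gK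
  have fL : ∀ k ∈ K, ∀ x, f (k * x) = f x := fun k hk x => by
    simpa using fK k hk 1 K.one_mem x
  have gL : ∀ k ∈ K, ∀ x, g (k * x) = g x := fun k hk x => by
    simpa using gK k hk 1 K.one_mem x
  have hgz : ∀ z, z ∉ tsupport g → g z = 0 := fun z hz => image_eq_zero_of_notMem_tsupport hz
  have hfz : ∀ z, z ∉ tsupport f → f z = 0 := fun z hz => image_eq_zero_of_notMem_tsupport hz
  have fs' : HasCompactSupport fun x => (f x : ℂ) :=
    HasCompactSupport.intro fs.isCompact fun x hx => by simp [hfz x hx]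
  have gs' : HasCompactSupport fun x => (g x : ℂ) :=
    HasCompactSupport.intro gs.isCompact fun x hx => by simp [hgz x hx]
  have fc' : Continuous fun x => (f x : ℂ) := by fun_prop
  have gc' : Continuous fun x => (g x : ℂ) := by fun_prop
  -- averaging over `K` does not change the double integrals
  have avg : ∀ P : G → G → K → ℂ, (Continuous fun q : G × G × K => P q.1 q.2.1 q.2.2) →
      ∫ y, ∫ z, ((f y : ℂ) * g z) * ∫ k : K, P y z k ∂μ ∂ν ∂ν =
        ∫ k : K, ∫ y, ∫ z, ((f y : ℂ) * g z) * P y z k ∂ν ∂ν ∂μ := fun P hP => by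
    have s1 : ∀ y, ∫ z, ((f y : ℂ) * g z) * ∫ k : K, P y z k ∂μ ∂ν =
        ∫ k : K, ∫ z, ((f y : ℂ) * g z) * P y z k ∂ν ∂μ := fun y => by
      simp only [← integral_const_mul]
      refine integral_integral_swap_of_hasCompactSupport ?_ ?_
      · change Continuous fun q : G × K => ((f y : ℂ) * g q.1) * P y q.1 q.2
        have : Continuous fun q : G × K => P y q.1 q.2 := 
          hP.comp (f := fun q : G × K => (y, q.1, q.2)) (by fun_prop)
        fun_prop
      · refine HasCompactSupport.intro (gs.isCompact.prod isCompact_univ) fun q hq => ?_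
        have : q.1 ∉ tsupport g := fun h => hq ⟨h, Set.mem_univ _⟩
        simp [Function.uncurry, hgz _ this]
    simp only [s1]
    refine integral_integral_swap_of_hasCompactSupport ?_ ?_
    · refine continuous_integral_of_forall_notMem
        (f := fun (q : G × K) z => ((f q.1 : ℂ) * g z) * P q.1 z q.2) ?_ gs.isCompact
        fun q z hz => by simp [hgz z hz]
      change Continuous fun q : (G × K) × G => ((f q.1.1 : ℂ) * g q.2) * P q.1.1 q.2 q.1.2
      have : Continuous fun q : (G × K) × G => P q.1.1 q.2 q.1.2 :=
        hP.comp (f := fun q : (G × K) × G => (q.1.1, q.2, q.1.2)) (by fun_prop)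
      fun_prop
    · refine HasCompactSupport.intro (fs.isCompact.prod isCompact_univ) fun q hq => ?_
      have : q.1 ∉ tsupport f := fun h => hq ⟨h, Set.mem_univ _⟩
      simp [Function.uncurry, hfz _ this]
  -- The two sides are the integrals of f ∗ g and g ∗ f against φ; this is where commutativity of
  -- convolution enters.
  have key : ∫ y, ∫ z, ((f y : ℂ) * g z) * φ (y * z) ∂ν ∂ν =
      ∫ y, ∫ z, ((f y : ℂ) * g z) * φ (z * y) ∂ν ∂ν := by
    rw [← integral_conv_mul fc' gc' fs' gs' hφ]
    have h1 := hK.2 _ _ (fc'.integrable_of_hasCompactSupport fs')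
      (gc'.integrable_of_hasCompactSupport gs')
      (fun k₁ h₁ k₂ h₂ x => by rw [fK k₁ h₁ k₂ h₂]) (fun k₁ h₁ k₂ h₂ x => by rw [gK k₁ h₁ k₂ h₂])
    rw [integral_congr_ae (h1.mono fun x hx => congrArg (· * φ x) hx),
      integral_conv_mul gc' fc' gs' fs' hφ, integral_integral_swap_of_hasCompactSupport]
    · simp only [mul_comm (g _ : ℂ)]; rfl
    · change Continuous fun q : G × G => ((g q.1 : ℂ) * f q.2) * φ (q.1 * q.2)
      fun_prop
    · refine HasCompactSupport.intro (gs.isCompact.prod fs.isCompact) fun q hq => ?_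
      by_cases h1 : q.1 ∈ tsupport g
      · have : q.2 ∉ tsupport f := fun h => hq ⟨h1, h⟩
        simp [Function.uncurry, hfz _ this]
      · simp [Function.uncurry, hgz _ h1]
  -- The element `k` stands directly to the left of an integration variable, so left invariance of
  -- `ν` and of the test function absorbs it.
  have left : ∀ k : K, ∫ y, ∫ z, ((f y : ℂ) * g z) * φ (y * k * z) ∂ν ∂ν =
      ∫ y, ∫ z, ((f y : ℂ) * g z) * φ (y * z) ∂ν ∂ν := fun k => by
    refine integral_congr_ae (Eventually.of_forall fun y => ?_)
    simp only
    rw [← integral_mul_left_eq_self (μ := ν) (fun z => ((f y : ℂ) * g z) * φ (y * z)) (k : G)]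
    simp only [gL _ k.2, mul_assoc]
  have right : ∀ k : K, ∫ y, ∫ z, ((f y : ℂ) * g z) * φ (z * k * y) ∂ν ∂ν =
      ∫ y, ∫ z, ((f y : ℂ) * g z) * φ (z * y) ∂ν ∂ν := fun k => by
    rw [← integral_mul_left_eq_self (μ := ν)
      (fun y => ∫ z, ((f y : ℂ) * g z) * φ (z * y) ∂ν) (k : G)]
    simp only [fL _ k.2, mul_assoc]
  have A1 := avg (fun y z k => φ (y * k * z)) (by fun_prop)
  have A2 := avg (fun y z k => φ (z * k * y)) (by fun_prop)
  simp only [left, right, ← key] at A1 A2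
  have A3 := A1.trans A2.symm
  have dcont : ∀ J : G → G → ℂ, (Continuous fun p : G × G => J p.1 p.2) →
      (∀ y, Integrable (fun z => ((f y : ℂ) * g z) * J y z) ν) ∧
        Integrable (fun y => ∫ z, ((f y : ℂ) * g z) * J y z ∂ν) ν := fun J hJ => by
    refine ⟨fun y => Continuous.integrable_of_hasCompactSupport ?_
      (HasCompactSupport.intro gs.isCompact fun z hz => by simp [hgz z hz]),
      Continuous.integrable_of_hasCompactSupport (continuous_integral_of_forall_notMem ?_
        gs.isCompact fun y z hz => by simp [hgz z hz])
      (HasCompactSupport.intro fs.isCompact fun z hz => by simp [hfz z hz])⟩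
    · have : Continuous fun z => J y z := hJ.comp (f := fun z => (y, z)) (by fun_prop)
      fun_prop
    · change Continuous fun p : G × G => ((f p.1 : ℂ) * g p.2) * J p.1 p.2
      fun_prop
  obtain ⟨D1, D1'⟩ := dcont (fun y z => ∫ k : K, φ (y * k * z) ∂μ) cI
  obtain ⟨D2, D2'⟩ := dcont (fun y z => ∫ k : K, φ (z * k * y) ∂μ) swap
  simp only [mul_sub]
  calc _ = ∫ y, (∫ z, ((f y : ℂ) * g z) * ∫ k : K, φ (y * k * z) ∂μ ∂ν -
        ∫ z, ((f y : ℂ) * g z) * ∫ k : K, φ (z * k * y) ∂μ ∂ν) ∂ν :=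
        integral_congr_ae (Eventually.of_forall fun y => integral_sub (D1 y) (D2 y))
    _ = 0 := by rw [integral_sub D1' D2', A3, sub_self]

end Test

open scoped InnerProductSpace
open ContinuousLinearMap (adjoint adjoint_inner_left adjoint_inner_right)

/-! ### The commutant of the translations, and infima in the cone P♮(G). -/

section Operators

universe u

variable {G : Type u} [Group G] {H : Type*} [NormedAddCommGroup H] [InnerProductSpace ℂ H]
  {e : G → H} {φ : G → ℂ}

lemma fixed_of_biinvariant {K : Subgroup G} (he : DenseRange (Finsupp.linearCombination ℂ e))
    (hφ : ∀ g h, ⟪e g, e h⟫_ℂ = φ (g⁻¹ * h)) (hK : IsBiinvariant K φ) {k : G} (hk : k ∈ K) :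
    e k = e 1 := by
  refine eq_of_inner_total he fun g => ?_
  simpa [hφ] using hK 1 K.one_mem k hk g⁻¹

/-- Expanding the square, ‖e g - e a‖² is 2φ(1) - φ(a⁻¹g) - φ(g⁻¹a), which tends to 0 as g → a. -/
lemma continuous_of_inner_eq [TopologicalSpace G] [IsTopologicalGroup G] (hφ : ∀ g h, ⟪e g, e h⟫_ℂ = φ (g⁻¹ * h))
    (hc : Continuous φ) : Continuous e := by
  rw [continuous_iff_continuousAt]
  intro a
  rw [ContinuousAt, tendsto_iff_norm_sub_tendsto_zero]
  have h1 : ∀ g, ‖e g - e a‖ = √(RCLike.re (φ 1 - φ (a⁻¹ * g) - (φ (g⁻¹ * a) - φ 1))) := fun g => by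
    rw [@norm_eq_sqrt_re_inner ℂ]
    simp only [inner_sub_left, inner_sub_right, hφ, inv_mul_cancel]
  simp only [h1]
  have h2 : Continuous fun g => √(RCLike.re (φ 1 - φ (a⁻¹ * g) - (φ (g⁻¹ * a) - φ 1))) := by
    fun_prop
  have h3 := h2.tendsto a
  simpa using h3

variable [CompleteSpace H]

lemma exists_translations (he : DenseRange (Finsupp.linearCombination ℂ e))
    (hφ : ∀ g h, ⟪e g, e h⟫_ℂ = φ (g⁻¹ * h)) :
    ∃ U : G → H →L[ℂ] H, (∀ g h, U g (e h) = e (g * h)) ∧ ∀ g, adjoint (U g) = U g⁻¹ := by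
  have h1 : ∀ g, ∃ V : H →L[ℂ] H, ∀ h, V (e h) = e (g * h) := fun g => by
    refine exists_clm_of_total he fun x => ?_
    rw [@norm_eq_sqrt_re_inner ℂ, @norm_eq_sqrt_re_inner ℂ, inner_linearCombination,
      inner_linearCombination]
    simp [hφ, mul_assoc]
  choose U hU using h1
  refine ⟨U, hU, fun g => clm_ext_total he fun h => eq_of_inner_total he fun a => ?_⟩
  rw [adjoint_inner_right, hU, hU, hφ, hφ]
  simp [mul_assoc]

/-- A function of positive type dominated by `φ` is given by an operator on the space of `φ`. -/
lemma exists_clm_of_le (he : DenseRange (Finsupp.linearCombination ℂ e))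
    (hφ : ∀ g h, ⟪e g, e h⟫_ℂ = φ (g⁻¹ * h)) {ψ : G → ℂ} (hψ : IsPositiveType ψ)
    (hle : IsPositiveType (φ - ψ)) : ∃ T : H →L[ℂ] H, ∀ g h, ⟪e g, T (e h)⟫_ℂ = ψ (g⁻¹ * h) := by
  obtain ⟨H', _, _, _, e', he', hψ'⟩ := hψ.exists_gns
  have hn : ∀ x, ‖Finsupp.linearCombination ℂ e' x‖ ≤ ‖Finsupp.linearCombination ℂ e x‖ := by
    intro x
    rw [@norm_eq_sqrt_re_inner ℂ, @norm_eq_sqrt_re_inner ℂ _ _ _ _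
      (Finsupp.linearCombination ℂ e x), inner_linearCombination, inner_linearCombination]
    refine Real.sqrt_le_sqrt ?_
    have h := (Complex.le_def.1 (hle.finsupp_nonneg x)).1
    simp only [Pi.sub_apply, mul_sub, Finsupp.sum_sub, Complex.sub_re, Complex.zero_re,
      sub_nonneg] at h
    simp only [hφ, hψ']
    exact h
  obtain ⟨V, hV⟩ := exists_clm_of_total he hn
  -- `V` is the contraction from the space of φ to that of ψ, so V*V has the coefficients ψ.
  exact ⟨adjoint V ∘L V, fun g h => by
    simp only [ContinuousLinearMap.comp_apply, adjoint_inner_right, hV, hψ']⟩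

variable {U : G → H →L[ℂ] H}

/-- Coefficients depending only on g⁻¹h do not change when both arguments are translated on the
left. -/
lemma translation_comm (he : DenseRange (Finsupp.linearCombination ℂ e))
    (hU : ∀ g h, U g (e h) = e (g * h)) (hUa : ∀ g, adjoint (U g) = U g⁻¹)
    {T : H →L[ℂ] H} {ψ : G → ℂ} (hT : ∀ g h, ⟪e g, T (e h)⟫_ℂ = ψ (g⁻¹ * h)) (g : G) :
    Commute T (U g) := by
  refine clm_ext_total he fun h => eq_of_inner_total he fun a => ?_
  change ⟪e a, T (U g (e h))⟫_ℂ = ⟪e a, U g (T (e h))⟫_ℂ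
  rw [← adjoint_inner_left (U g), hUa, hU, hU, hT, hT]
  simp [mul_assoc]

lemma inner_eq_of_translation_comm (hU : ∀ g h, U g (e h) = e (g * h))
    (hUa : ∀ g, adjoint (U g) = U g⁻¹) {T : H →L[ℂ] H} (hT : ∀ g, Commute T (U g)) (g h : G) :
    ⟪e g, T (e h)⟫_ℂ = ⟪e 1, T (e (g⁻¹ * h))⟫_ℂ := by
  have h1 : T (U g⁻¹ (e h)) = U g⁻¹ (T (e h)) := DFunLike.congr_fun (hT g⁻¹).eq (e h)
  rw [← hU g⁻¹ h, h1, ← adjoint_inner_left (U g⁻¹), hUa, hU, inv_inv, mul_one]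

variable [TopologicalSpace G]

/-- Positive operators commuting with the translations give elements of the cone. -/
lemma coeff_mem_posTypeCone {K : Subgroup G} (hU : ∀ g h, U g (e h) = e (g * h))
    (hUa : ∀ g, adjoint (U g) = U g⁻¹) (hec : Continuous e) (hfix : ∀ k ∈ K, e k = e 1)
    {T : H →L[ℂ] H} (hT : ∀ g, Commute T (U g)) (h0 : 0 ≤ T) :
    (fun g => ⟪e 1, T (e g)⟫_ℂ) ∈ posTypeCone K := by
  refine ⟨by fun_prop, positiveType_of_nonneg
    (fun g h => inner_eq_of_translation_comm hU hUa hT g h) h0, fun k₁ h₁ k₂ h₂ g => ?_⟩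
  have h := inner_eq_of_translation_comm hU hUa hT k₁⁻¹ g
  rw [inv_inv, hfix _ (K.inv_mem h₁)] at h
  change ⟪e 1, T (e (k₁ * g * k₂))⟫_ℂ = _
  rw [← hU (k₁ * g) k₂, hfix _ h₂, hU, mul_one]
  exact h.symm

variable [IsTopologicalGroup G] [LocallyCompactSpace G] [MeasurableSpace G] [BorelSpace G]

/-- For a Gelfand pair, self-adjoint operators commuting with the translations commute. -/
theorem IsGelfandPair.commute_of_translation_comm {K : Subgroup G} (hK : IsGelfandPair K)
    (he : DenseRange (Finsupp.linearCombination ℂ e))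
    (hU : ∀ g h, U g (e h) = e (g * h)) (hUa : ∀ g, adjoint (U g) = U g⁻¹) (hec : Continuous e)
    (hfix : ∀ k ∈ K, e k = e 1) {S T : H →L[ℂ] H} (hS : ∀ g, Commute S (U g))
    (hT : ∀ g, Commute T (U g)) (hSa : adjoint S = S) (hTa : adjoint T = T) : Commute S T := by
  have : CompactSpace K := isCompact_iff_compactSpace.1 hK.1
  let μ : Measure K := Measure.haarMeasure ⊤
  have : IsProbabilityMeasure μ := ⟨by
    simpa using Measure.haarMeasure_self (K₀ := (⊤ : TopologicalSpace.PositiveCompacts K))⟩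
  have hSU : ∀ g x, S (U g x) = U g (S x) := fun g x => DFunLike.congr_fun (hS g).eq x
  have hTU : ∀ g x, T (U g x) = U g (T x) := fun g x => DFunLike.congr_fun (hT g).eq x
  have hUin : ∀ g x y, ⟪x, U g y⟫_ℂ = ⟪U g⁻¹ x, y⟫_ℂ := fun g x y => by
    rw [← hUa, adjoint_inner_left]
  -- The K-fixed vectors. The projection `P` onto them averages over K (`hPe`), which links the
  -- operators to the integrals over K.
  let W : Submodule ℂ H :=
    { carrier := {w | ∀ k ∈ K, U k w = w}
      zero_mem' := fun k _ => map_zero _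
      add_mem' := fun {x y} hx hy k hk => by rw [map_add, hx k hk, hy k hk]
      smul_mem' := fun c x hx k hk => by rw [map_smul, hx k hk] }
  have hWc : IsClosed (W : Set H) := by
    have : (W : Set H) = ⋂ k ∈ K, {w | U k w = w} := by
      ext w; simp [W]
    rw [this]
    exact isClosed_biInter fun k _ => isClosed_eq (U k).continuous continuous_id
  have : CompleteSpace W := hWc.completeSpace_coe
  let P : H →L[ℂ] H := W.starProjection
  have hPW : ∀ x, P x ∈ W := fun x => Submodule.starProjection_apply_mem W x
  have hPid : ∀ x ∈ W, P x = x := fun x hx => Submodule.starProjection_eq_self_iff.2 hx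
  have hPin : ∀ x y, ⟪P x, y⟫_ℂ = ⟪x, P y⟫_ℂ := fun x y =>
    Submodule.inner_starProjection_left_eq_right W x y
  have hPa : adjoint P = P := by
    refine ((ContinuousLinearMap.eq_adjoint_iff P P).2 hPin).symm
  have hPeq : ∀ x y, y ∈ W → (∀ w ∈ W, ⟪w, y⟫_ℂ = ⟪w, x⟫_ℂ) → P x = y := fun x y hy h => by
    refine Submodule.eq_starProjection_of_mem_of_inner_eq_zero hy fun w hw => ?_
    rw [← inner_conj_symm, inner_sub_right, h w hw, sub_self, map_zero]
  have hWS : ∀ R : H →L[ℂ] H, (∀ g x, R (U g x) = U g (R x)) → ∀ w ∈ W, R w ∈ W :=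
    fun R hR w hw k hk => by rw [← hR, hw k hk]
  have hPS : ∀ R : H →L[ℂ] H, (∀ g x, R (U g x) = U g (R x)) → adjoint R = R →
      ∀ x, R (P x) = P (R x) := fun R hR hRa x => by
    refine (hPeq _ _ (hWS R hR _ (hPW x)) fun w hw => ?_).symm
    rw [← adjoint_inner_left R, hRa, ← hPin, hPid _ (hWS R hR w hw), ← adjoint_inner_left R, hRa]
  have hv : e 1 ∈ W := fun k hk => by rw [hU, mul_one, hfix k hk]
  have hint : ∀ b, Integrable (fun k : K => e (k * b)) μ := fun b =>
    Continuous.integrable_of_hasCompactSupport (by fun_prop) (HasCompactSupport.of_compactSpace _)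
  have hPe : ∀ b, P (e b) = ∫ k : K, e (k * b) ∂μ := fun b => by
    refine hPeq _ _ (fun k hk => ?_) fun w hw => ?_
    · rw [← ContinuousLinearMap.integral_comp_comm _ (hint b)]
      simp only [hU, ← mul_assoc]
      exact integral_mul_left_eq_self (μ := μ) (fun l : K => e (l * b)) ⟨k, hk⟩
    · have h1 : ∀ k : K, ⟪w, e (k * b)⟫_ℂ = ⟪w, e b⟫_ℂ := fun k => by
        rw [← hU, hUin, hw _ (K.inv_mem k.2)]
      rw [← integral_inner (hint b)]
      simp [h1]
  let A : G → H →L[ℂ] H := fun g => P * U g * P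
  have hA : ∀ g x, A g x = P (U g (P x)) := fun g x => rfl
  have hAv : ∀ g, A g (e 1) = P (e g) := fun g => by
    rw [hA, hPid _ hv, hU, mul_one]
  have hAin : ∀ a b c, ⟪e c, A a (A b (e 1))⟫_ℂ = ∫ k : K, ⟪P (e c), e (a * k * b)⟫_ℂ ∂μ :=
    fun a b c => by
      rw [hAv, hA, ← hPin, hPid _ (hPW _), hUin, hPe b, ← integral_inner (hint b)]
      refine integral_congr_ae (Eventually.of_forall fun k => ?_)
      simp only
      rw [mul_assoc, ← hU a, hUin]
  -- By `hAin`, this is the functional equation for the biinvariant function g ↦ ⟪P (e c), e g⟫.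
  have hAcomm : ∀ a b, A a (A b (e 1)) = A b (A a (e 1)) := fun a b => by
    refine eq_of_inner_total he fun c => ?_
    rw [hAin, hAin]
    refine hK.integral_comm μ (φ := fun g => ⟪P (e c), e g⟫_ℂ) (by fun_prop)
      (fun k₁ h₁ k₂ h₂ g => ?_) a b
    change ⟪P (e c), e (k₁ * g * k₂)⟫_ℂ = _
    rw [← hU (k₁ * g) k₂, hfix _ h₂, hU, mul_one, ← hU, hUin, hPW _ _ (K.inv_mem h₁)]
  have hRA : ∀ R : H →L[ℂ] H, (∀ g x, R (U g x) = U g (R x)) → adjoint R = R →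
      ∀ a ∈ Submodule.span ℂ (Set.range A), ∀ x, R (a x) = a (R x) := fun R hR hRa a ha x => by
    induction ha using Submodule.span_induction with
    | mem a h =>
      obtain ⟨g, rfl⟩ := h
      rw [hA, hA, hPS R hR hRa, hR, hPS R hR hRa]
    | zero => simp
    | add a b _ _ ha hb => simp [ha, hb]
    | smul c a _ ha => simp [ha]
  have hadj : ∀ a ∈ Submodule.span ℂ (Set.range A), adjoint a ∈ Submodule.span ℂ (Set.range A) := by
    intro a ha
    induction ha using Submodule.span_induction with
    | mem a h =>
      obtain ⟨g, rfl⟩ := h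
      have : adjoint (A g) = A g⁻¹ := by
        change star (P * U g * P) = P * U g⁻¹ * P
        rw [star_mul, star_mul, ContinuousLinearMap.star_eq_adjoint,
          ContinuousLinearMap.star_eq_adjoint, hPa, hUa, mul_assoc]
      rw [this]
      exact Submodule.subset_span ⟨_, rfl⟩
    | zero => rw [map_zero]; exact zero_mem _
    | add a b _ _ ha hb => rw [map_add]; exact add_mem ha hb
    | smul c a _ ha => rw [map_smulₛₗ]; exact Submodule.smul_mem _ _ ha
  have hcomm : ∀ a ∈ Submodule.span ℂ (Set.range A), ∀ b ∈ Submodule.span ℂ (Set.range A),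
      a (b (e 1)) = b (a (e 1)) := by
    intro a ha b hb
    induction ha using Submodule.span_induction with
    | mem a h =>
      obtain ⟨g, rfl⟩ := h
      induction hb using Submodule.span_induction with
      | mem b h =>
        obtain ⟨g', rfl⟩ := h
        exact hAcomm g g'
      | zero => simp
      | add a b _ _ ha hb => simp [ha, hb]
      | smul c a _ ha => simp [ha]
    | zero => simp
    | add a b _ _ ha hb => simp [ha, hb]
    | smul c a _ ha => simp [ha]
  -- `T (e 1)` is K-fixed. Approximate it by combinations of the `e g` and apply `P`: each `P (e g)`
  -- equals `A g (e 1)`.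
  have hTv : T (e 1) ∈ closure ((fun a : H →L[ℂ] H => a (e 1)) ''
      (Submodule.span ℂ (Set.range A) : Set (H →L[ℂ] H))) := by
    rw [← hPid _ (hWS T hTU _ hv)]
    have h1 := image_closure_subset_closure_image P.continuous
      (s := Set.range (Finsupp.linearCombination ℂ e))
    rw [he.closure_range] at h1
    refine closure_mono ?_ (h1 ⟨T (e 1), Set.mem_univ _, rfl⟩)
    rintro _ ⟨_, ⟨x, rfl⟩, rfl⟩
    refine ⟨x.sum fun g c => c • A g, Submodule.sum_mem _ fun g _ =>
      Submodule.smul_mem _ _ (Submodule.subset_span ⟨g, rfl⟩), ?_⟩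
    simp only [Finsupp.linearCombination_apply, Finsupp.sum, map_sum, map_smul,
      sum_apply, smul_apply, hAv]
  have hmain : S (T (e 1)) = T (S (e 1)) := by
    refine eq_of_inner_total he fun g => ?_
    have h1 := inner_commutant_comm _ hadj hcomm (hRA S hSU hSa) (hRA T hTU hTa) hTa hTv
      (Submodule.subset_span ⟨g, rfl⟩)
    rw [hAv, hPin, hPin, hPid _ (hWS S hSU _ (hWS T hTU _ hv)),
      hPid _ (hWS T hTU _ (hWS S hSU _ hv))] at h1
    exact h1
  refine clm_ext_total he fun g => ?_
  change S (T (e g)) = T (S (e g))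
  rw [← mul_one g, ← hU, hTU, hSU, hmain, ← hTU, ← hSU]

/-- For a Gelfand pair, any two elements of the cone of bi-invariant continuous functions of
positive type have an infimum. -/
theorem IsGelfandPair.exists_isConeInf {K : Subgroup G} (hK : IsGelfandPair K) {φ₁ φ₂ : G → ℂ}
    (h₁ : φ₁ ∈ posTypeCone K) (h₂ : φ₂ ∈ posTypeCone K) :
    ∃ ω, IsConeInf (posTypeCone K) φ₁ φ₂ ω := by
  -- The sum dominates both functions and all their lower bounds, so all are represented by
  -- operators on one space.
  have hφ : φ₁ + φ₂ ∈ posTypeCone K := add_mem h₁ h₂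
  obtain ⟨H, _, _, _, e, he, hin⟩ := hφ.2.1.exists_gns
  obtain ⟨U, hU, hUa⟩ := exists_translations he hin
  have hec := continuous_of_inner_eq hin hφ.1
  have hfix : ∀ k ∈ K, e k = e 1 := fun k hk => fixed_of_biinvariant he hin hφ.2.2 hk
  obtain ⟨T₁, hT₁⟩ := exists_clm_of_le he hin h₁.2.1 (by simpa using h₂.2.1)
  obtain ⟨T₂, hT₂⟩ := exists_clm_of_le he hin h₂.2.1 (by simpa using h₁.2.1)
  have p₁ : 0 ≤ T₁ := nonneg_of_positiveType he h₁.2.1 hT₁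
  have p₂ : 0 ≤ T₂ := nonneg_of_positiveType he h₂.2.1 hT₂
  have c₁ := translation_comm he hU hUa hT₁
  have c₂ := translation_comm he hU hUa hT₂
  have sa : ∀ {T : H →L[ℂ] H}, 0 ≤ T → adjoint T = T := fun hT =>
    (IsSelfAdjoint.of_nonneg hT).star_eq
  have comm : ∀ {S T : H →L[ℂ] H}, (∀ g, Commute S (U g)) → (∀ g, Commute T (U g)) →
      0 ≤ S → 0 ≤ T → Commute S T := fun hS hT h0 h0' =>
    hK.commute_of_translation_comm he hU hUa hec hfix hS hT (sa h0) (sa h0')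
  have hD : T₁ - T₂ = (T₁ - T₂)⁺ - (T₁ - T₂)⁻ := (CFC.posPart_sub_negPart (T₁ - T₂)
    ((IsSelfAdjoint.of_nonneg p₁).sub (IsSelfAdjoint.of_nonneg p₂))).symm
  have cD : ∀ R : H →L[ℂ] H, Commute (T₁ - T₂) R → Commute (T₁ - T₂)⁺ R := fun R hR => by
    rw [CFC.posPart_def]; exact hR.cfcₙ_real _
  have pP : 0 ≤ (T₁ - T₂)⁺ := CFC.posPart_nonneg _
  have pN : 0 ≤ (T₁ - T₂)⁻ := CFC.negPart_nonneg _
  have cP : ∀ g, Commute (T₁ - T₂)⁺ (U g) := fun g => cD _ ((c₁ g).sub_left (c₂ g))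
  have cM : ∀ g, Commute (T₁ - (T₁ - T₂)⁺) (U g) := fun g => (c₁ g).sub_left (cP g)
  have e₁ : T₁ - (T₁ - T₂)⁺ + (T₁ - T₂)⁺ = T₁ := by abel
  have e₂ : T₁ - (T₁ - T₂)⁺ + (T₁ - T₂)⁻ = T₂ := by
    rw [← sub_add_cancel (T₁ - T₂)⁺ (T₁ - T₂)⁻, ← hD]; abel
  have saM : IsSelfAdjoint (T₁ - (T₁ - T₂)⁺) :=
    (IsSelfAdjoint.of_nonneg p₁).sub (IsSelfAdjoint.of_nonneg pP)
  have c12 : Commute T₁ T₂ := comm c₁ c₂ p₁ p₂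
  have cMD : Commute (T₁ - (T₁ - T₂)⁺) (T₁ - T₂) :=
    ((Commute.refl _).sub_right c12).sub_left (cD _ (Commute.refl _))
  have pM : 0 ≤ T₁ - (T₁ - T₂)⁺ :=
    nonneg_of_add_posPart_of_add_negPart saM cMD (e₁.symm ▸ p₁) (e₂.symm ▸ p₂)
  have coeff : ∀ {ψ : G → ℂ} {T : H →L[ℂ] H}, (∀ g h, ⟪e g, T (e h)⟫_ℂ = ψ (g⁻¹ * h)) →
      ψ = fun g => ⟪e 1, T (e g)⟫_ℂ := fun hT => funext fun g => by simp [hT]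
  have coeff_sub : ∀ S T : H →L[ℂ] H, (fun g => ⟪e 1, S (e g)⟫_ℂ) - (fun g => ⟪e 1, T (e g)⟫_ℂ) =
      fun g => ⟪e 1, (S - T) (e g)⟫_ℂ := fun S T => funext fun g => by
    simp
  refine ⟨fun g => ⟪e 1, (T₁ - (T₁ - T₂)⁺) (e g)⟫_ℂ,
    coeff_mem_posTypeCone hU hUa hec hfix cM pM, ?_, ?_, fun w hw hw₁ hw₂ => ?_⟩
  · rw [ConeLE, coeff hT₁, coeff_sub]
    refine coeff_mem_posTypeCone hU hUa hec hfix (fun g => (c₁ g).sub_left (cM g)) ?_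
    rwa [sub_sub_cancel]
  · rw [ConeLE, coeff hT₂, coeff_sub]
    refine coeff_mem_posTypeCone hU hUa hec hfix (fun g => (c₂ g).sub_left (cM g)) ?_
    rwa [sub_nonneg, ← sub_nonneg, ← eq_sub_iff_add_eq'.2 e₂]
  · have hle : IsPositiveType (φ₁ + φ₂ - w) := by
      have h := add_mem hw₁ h₂
      rw [sub_add_eq_add_sub] at h
      exact h.2.1
    obtain ⟨T, hT⟩ := exists_clm_of_le he hin hw.2.1 hle
    have p : 0 ≤ T := nonneg_of_positiveType he hw.2.1 hT
    have c := translation_comm he hU hUa hT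
    have q : ∀ {S : H →L[ℂ] H} {ψ : G → ℂ}, (∀ g h, ⟪e g, S (e h)⟫_ℂ = ψ (g⁻¹ * h)) →
        ConeLE (posTypeCone K) w ψ → 0 ≤ S - T := fun {S ψ} hS hle =>
      nonneg_of_positiveType he hle.2.1 fun g h => by
        simp [hS, hT]
    rw [ConeLE, coeff hT, coeff_sub]
    refine coeff_mem_posTypeCone hU hUa hec hfix (fun g => (cM g).sub_left (c g)) ?_
    -- With M = T₁ - (T₁ - T₂)⁺, the element M - T plus the positive or negative part of T₁ - T₂ is
    -- T₁ - T or T₂ - T, both nonnegative.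
    refine nonneg_of_add_posPart_of_add_negPart (saM.sub (IsSelfAdjoint.of_nonneg p))
      (cMD.sub_left ((comm c c₁ p p₁).sub_right (comm c c₂ p p₂))) ?_ ?_
    · rw [sub_add_eq_add_sub, e₁]; exact q hT₁ hw₁
    · rw [sub_add_eq_add_sub, e₂]; exact q hT₂ hw₂

end Operators

/-! ### From infima to suprema in a cone. -/

section ConeLattice

variable {E : Type*} [AddCommGroup E] [Module ℝ E] {C : PointedCone ℝ E}

/-- In a cone in which all infima exist, infima are invariant under translations. -/
lemma IsConeInf.add_left_le (hC : ∀ x ∈ C, ∀ y ∈ C, ∃ z, IsConeInf C x y z) {x y z a w : E}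
    (hx : x ∈ C) (hy : y ∈ C) (ha : a ∈ C) (hz : IsConeInf C x y z) (hw : w ∈ C)
    (hwx : ConeLE C w (a + x)) (hwy : ConeLE C w (a + y)) : ConeLE C w (a + z) := by
  obtain ⟨m, hm, hmx, hmy, hmax⟩ := hC _ (add_mem ha hx) _ (add_mem ha hy)
  -- `a` is itself a common lower bound, so `m - a` lies in the cone and competes with `z` below `x`
  -- and `y`.
  have ham : ConeLE C a m := hmax a ha (by simpa [ConeLE] using hx) (by simpa [ConeLE] using hy)
  have h1 : ConeLE C (m - a) z := by
    refine hz.2.2.2 _ ham ?_ ?_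
    · have : x - (m - a) = a + x - m := by abel
      rw [ConeLE, this]; exact hmx
    · have : y - (m - a) = a + y - m := by abel
      rw [ConeLE, this]; exact hmy
  have h2 : a + z - w = (z - (m - a)) + (m - w) := by abel
  rw [ConeLE, h2]
  exact add_mem h1 (hmax w hw hwx hwy)

/-- In a cone in which all infima exist, `x ∨ y = x + y - x ∧ y`. -/
lemma IsConeInf.isConeSup (hC : ∀ x ∈ C, ∀ y ∈ C, ∃ z, IsConeInf C x y z) {x y z : E}
    (hx : x ∈ C) (hy : y ∈ C) (hz : IsConeInf C x y z) : IsConeSup C x y (x + y - z) := by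
  have e1 : x + y - z = x + (y - z) := by abel
  have e2 : x + y - z - x = y - z := by abel
  have e3 : x + y - z - y = x - z := by abel
  refine ⟨e1 ▸ add_mem hx hz.2.2.1, ?_, ?_, fun w hw hxw hyw => ?_⟩
  · rw [ConeLE, e2]; exact hz.2.2.1
  · rw [ConeLE, e3]; exact hz.2.1
  -- An upper bound `w` of `x` and `y` makes `x + y` a lower bound of `w + x` and `w + y`;
  -- translating the infimum by `w` gives x + y ≪ w + z.
  · have h := hz.add_left_le hC hx hy hw (add_mem hx hy) (w := x + y) ?_ ?_
    · have : w - (x + y - z) = w + z - (x + y) := by abel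
      rw [ConeLE, this]; exact h
    · have : w + x - (x + y) = w - y := by abel
      rw [ConeLE, this]; exact hyw
    · have : w + y - (x + y) = w - x := by abel
      rw [ConeLE, this]; exact hxw

end ConeLattice

/-! ### Uniform convergence in the cone P♮(G). -/

section PosTypeCone

variable {G : Type*} [Group G]

/-- Cauchy–Schwarz in the GNS space, where all `e g` have the same norm. Uniform convergence of
monotone sequences is thereby reduced to convergence at 1. -/
lemma IsPositiveType.norm_le {φ : G → ℂ} (hφ : IsPositiveType φ) (g : G) : ‖φ g‖ ≤ (φ 1).re := by
  obtain ⟨H, _, _, _, e, -, he⟩ := hφ.exists_gns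
  have hn : ∀ a, ‖e a‖ * ‖e a‖ = (φ 1).re := fun a => by
    rw [← inner_self_eq_norm_mul_norm (𝕜 := ℂ), he, inv_mul_cancel]; rfl
  have h1 := norm_inner_le_norm (𝕜 := ℂ) (e 1) (e g)
  rw [he, inv_one, one_mul] at h1
  nlinarith [hn 1, hn g, mul_self_nonneg (‖e 1‖ - ‖e g‖)]

variable [TopologicalSpace G] {K : Subgroup G}

/-- The cone is closed under uniform limits. -/
lemma mem_posTypeCone_of_tendstoUniformly {h : ℕ → G → ℂ} {f : G → ℂ}
    (hh : ∀ n, h n ∈ posTypeCone K) (hlim : TendstoUniformly h f atTop) : f ∈ posTypeCone K := by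
  have hp : ∀ g, Tendsto (fun n => h n g) atTop (𝓝 (f g)) := fun g => hlim.tendsto_at g
  refine ⟨hlim.continuous (Eventually.of_forall fun n => (hh n).1).frequently, fun n g c => ?_,
    fun k₁ h₁ k₂ h₂ g => ?_⟩
  · refine ge_of_tendsto' (tendsto_finsetSum _ fun i _ => tendsto_finsetSum _ fun j _ =>
      (hp _).const_mul _) fun m => (hh m).2.1 n g c
  · refine tendsto_nhds_unique (hp _) ?_
    simp only [(hh _).2.2 k₁ h₁ k₂ h₂ g]
    exact hp g

/-- Sequences with bounded increments in the cone converge uniformly. -/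
lemma exists_tendstoUniformly_of_increments {h : ℕ → G → ℂ} {B : ℝ}
    (hinc : ∀ n, h (n + 1) - h n ∈ posTypeCone K) (hB : ∀ n, (h n 1).re ≤ B) :
    ∃ f, TendstoUniformly h f atTop := by
  have hle : ∀ m n, m ≤ n → h n - h m ∈ posTypeCone K := fun m n hmn => by
    induction n, hmn using Nat.le_induction with
    | base => rw [sub_self]; exact zero_mem _
    | succ n _ ih => rw [← sub_add_sub_cancel]; exact add_mem (hinc n) ih
  have hbd : ∀ m n, m ≤ n → ∀ g, ‖h n g - h m g‖ ≤ (h n 1).re - (h m 1).re := fun m n hmn g =>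
    (hle m n hmn).2.1.norm_le g
  have hmono : Monotone fun n => (h n 1).re := fun m n hmn => by
    have := (norm_nonneg _).trans (hbd m n hmn 1)
    linarith
  have hconv := tendsto_atTop_ciSup hmono ⟨B, by rintro _ ⟨n, rfl⟩; exact hB n⟩
  have hc := hconv.cauchySeq
  have hu : UniformCauchySeqOn h atTop Set.univ := by
    rw [Metric.uniformCauchySeqOn_iff]
    intro ε hε
    obtain ⟨N, hN⟩ := Metric.cauchySeq_iff.1 hc ε hε
    refine ⟨N, fun m hm n hn g _ => ?_⟩
    rcases le_total m n with hmn | hmn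
    · rw [dist_comm, dist_eq_norm]
      exact (hbd m n hmn g).trans_lt ((le_abs_self _).trans_lt (hN n hn m hm))
    · rw [dist_eq_norm]
      exact (hbd n m hmn g).trans_lt ((le_abs_self _).trans_lt (hN m hm n hn))
  have hpt : ∀ g, ∃ l, Tendsto (fun n => h n g) atTop (𝓝 l) := fun g =>
    cauchySeq_tendsto_of_complete (hu.cauchySeq (Set.mem_univ g))
  choose f hf using hpt
  exact ⟨f, tendstoUniformlyOn_univ.1 (hu.tendstoUniformlyOn_of_tendsto fun g _ => hf g)⟩

/-- Decreasing sequences of the cone converge uniformly, to an element of the cone. -/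
lemma exists_tendstoUniformly_of_decrements {h : ℕ → G → ℂ} (hh : ∀ n, h n ∈ posTypeCone K)
    (hdec : ∀ n, ConeLE (posTypeCone K) (h (n + 1)) (h n)) :
    ∃ f ∈ posTypeCone K, TendstoUniformly h f atTop := by
  obtain ⟨f, hf⟩ := exists_tendstoUniformly_of_increments (K := K) (h := fun n => h 0 - h n)
    (B := (h 0 1).re) (fun n => by rw [sub_sub_sub_cancel_left]; exact hdec n) fun n => by
      have := (norm_nonneg _).trans ((hh n).2.1.norm_le 1)
      simpa using this
  have h0 : TendstoUniformly (fun (_ : ℕ) => h 0) (h 0) atTop := by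
    rw [Metric.tendstoUniformly_iff]
    exact fun ε hε => Eventually.of_forall fun n x => by simpa using hε
  have h1 := h0.sub hf
  have e : ((fun (_ : ℕ) => h 0) - fun n => h 0 - h n) = h := funext fun n => sub_sub_cancel _ _
  rw [e] at h1
  exact ⟨h 0 - f, mem_posTypeCone_of_tendstoUniformly hh h1, h1⟩

end PosTypeCone

/-! ### Decompositions and lattice operations for subprojective systems. -/

section Systems

variable {G : ℕ → Type*} [∀ n, Group (G n)] (ι : ∀ n, G n →* G (n + 1))

/-- The indices k + 1 + j and k + (j + 1) are not definitionally equal; stating the equality in the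
sigma type avoids casts. -/
lemma sigma_embed_succ (k j : ℕ) (g : G k) :
    (⟨k + 1 + j, embed ι (k + 1) j (ι k g)⟩ : Σ n, G n) =
      ⟨k + (j + 1), embed ι k (j + 1) g⟩ := by
  induction j with
  | zero => rfl
  | succ j ih =>
    exact congrArg (fun p : Σ n, G n => (⟨p.1 + 1, ι p.1 p.2⟩ : Σ n, G n)) ih

lemma res_succ_apply (φ : ∀ n, G n → ℂ) (k j : ℕ) (g : G k) :
    res ι (k + 1) j (φ (k + 1 + j)) (ι k g) = res ι k (j + 1) (φ (k + (j + 1))) g :=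
  congrArg (fun p : Σ n, G n => φ p.1 p.2) (sigma_embed_succ ι k j g)

lemma embed_mem [∀ n, TopologicalSpace (G n)] {K : ∀ n, Subgroup (G n)}
    (hK : ∀ n, (K (n + 1)).comap (ι n) = K n) (k j : ℕ) {g : G k} (hg : g ∈ K k) :
    embed ι k j g ∈ K (k + j) := by
  induction j with
  | zero => exact hg
  | succ j ih =>
    have : embed ι k j g ∈ (K (k + j + 1)).comap (ι (k + j)) := by rw [hK]; exact ih
    exact this

lemma res_sub (k j : ℕ) (f g : G (k + j) → ℂ) : res ι k j (f - g) = res ι k j f - res ι k j g := rfl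

variable [∀ n, TopologicalSpace (G n)] {K : ∀ n, Subgroup (G n)}

lemma continuous_embed (hι : ∀ n, Continuous (ι n)) (k j : ℕ) : Continuous (embed ι k j) := by
  induction j with
  | zero => exact continuous_id
  | succ j ih => exact (hι (k + j)).comp ih

lemma res_mem_posTypeCone (hι : ∀ n, Continuous (ι n)) (hK : ∀ n, (K (n + 1)).comap (ι n) = K n)
    (k j : ℕ) {f : G (k + j) → ℂ} (hf : f ∈ posTypeCone (K (k + j))) :
    res ι k j f ∈ posTypeCone (K k) := by
  have hc := continuous_embed ι hι k j
  refine ⟨hf.1.comp hc, fun n g c => ?_, fun k₁ h₁ k₂ h₂ g => ?_⟩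
  · simpa [res] using hf.2.1 n (fun i => embed ι k j (g i)) c
  · simpa [res] using hf.2.2 _ (embed_mem ι hK k j h₁) _ (embed_mem ι hK k j h₂)
      (embed ι k j g)

variable {ι}

lemma IsDecomposition.tendsto {φ Φ ψ : ∀ n, G n → ℂ} (h : IsDecomposition K ι φ Φ ψ) (k : ℕ)
    (g : G k) : Tendsto (fun N => Φ k g + ∑ j ∈ Finset.range N, res ι k j (ψ (k + j)) g) atTop
      (𝓝 (φ k g)) := (h.2.2 k).tendsto_at g

/-- The second component of a decomposition. -/
lemma IsDecomposition.sub_res_eq {φ Φ ψ : ∀ n, G n → ℂ} (h : IsDecomposition K ι φ Φ ψ) (k : ℕ) :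
    φ k - res ι k 1 (φ (k + 1)) = ψ k := by
  funext g
  have h1 := (tendsto_add_atTop_iff_nat 1).2 (h.tendsto k g)
  have h2 := h.tendsto (k + 1) (ι k g)
  -- Splitting off the term j = 0 leaves the restriction of the partial sum at level k + 1, with one
  -- term fewer.
  have e : ∀ N, Φ k g + ∑ j ∈ Finset.range (N + 1), res ι k j (ψ (k + j)) g =
      ψ k g + (Φ (k + 1) (ι k g) +
        ∑ j ∈ Finset.range N, res ι (k + 1) j (ψ (k + 1 + j)) (ι k g)) := fun N => by
    have e0 : Φ (k + 1) (ι k g) = Φ k g := congrFun (h.1.2 k) g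
    rw [Finset.sum_range_succ', e0]
    simp only [res_succ_apply]
    change _ + (_ + ψ k g) = _
    ring
  simp only [e] at h1
  have := tendsto_nhds_unique h1 (h2.const_add (ψ k g))
  change φ k g - φ (k + 1) (ι k g) = ψ k g
  rw [this]; ring

lemma IsDecomposition.unique {φ Φ ψ Φ' ψ' : ∀ n, G n → ℂ} (h : IsDecomposition K ι φ Φ ψ)
    (h' : IsDecomposition K ι φ Φ' ψ') : Φ = Φ' ∧ ψ = ψ' := by
  have e : ψ = ψ' := funext fun k => (h.sub_res_eq k).symm.trans (h'.sub_res_eq k)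
  subst e
  refine ⟨funext fun k => funext fun g => ?_, rfl⟩
  have h1 := (h.tendsto k g).sub (h'.tendsto k g)
  simp only [add_sub_add_right_eq_sub, sub_self] at h1
  exact sub_eq_zero.1 (tendsto_nhds_unique tendsto_const_nhds h1)

lemma IsDecomposition.add {φ Φ ψ φ' Φ' ψ' : ∀ n, G n → ℂ} (h : IsDecomposition K ι φ Φ ψ)
    (h' : IsDecomposition K ι φ' Φ' ψ') : IsDecomposition K ι (φ + φ') (Φ + Φ') (ψ + ψ') := by
  refine ⟨add_mem h.1 h'.1, fun k => add_mem (h.2.1 k) (h'.2.1 k), fun k => ?_⟩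
  convert (h.2.2 k).add (h'.2.2 k) using 1
  · funext N g
    simp only [Pi.add_apply, res, Finset.sum_add_distrib]
    ring
  · rfl

lemma IsDecomposition.sub {φ Φ ψ φ' Φ' ψ' : ∀ n, G n → ℂ} (h : IsDecomposition K ι φ Φ ψ)
    (h' : IsDecomposition K ι φ' Φ' ψ') (hΦ : ConeLE (projCone K ι) Φ' Φ)
    (hψ : ∀ k, ConeLE (posTypeCone (K k)) (ψ' k) (ψ k)) :
    IsDecomposition K ι (φ - φ') (Φ - Φ') (ψ - ψ') := by
  refine ⟨hΦ, hψ, fun k => ?_⟩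
  convert (h.2.2 k).sub (h'.2.2 k) using 1
  · funext N g
    simp only [Pi.sub_apply, res, Finset.sum_sub_distrib]
    ring
  · rfl

variable (hι : ∀ n, Continuous (ι n)) (hK : ∀ n, (K (n + 1)).comap (ι n) = K n)
include hι hK

lemma IsDecomposition.mem_subprojCone {φ Φ ψ : ∀ n, G n → ℂ} (h : IsDecomposition K ι φ Φ ψ) :
    φ ∈ subprojCone K ι := by
  refine ⟨fun k => mem_posTypeCone_of_tendstoUniformly (fun N => ?_) (h.2.2 k), fun k => ?_⟩
  · have : (fun g => Φ k g + ∑ j ∈ Finset.range N, res ι k j (ψ (k + j)) g) =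
        Φ k + ∑ j ∈ Finset.range N, res ι k j (ψ (k + j)) := by
      funext g; simp
    rw [this]
    exact add_mem (h.1.1 k) (sum_mem fun j _ => res_mem_posTypeCone ι hι hK k j (h.2.1 _))
  · rw [ConeLE, h.sub_res_eq k]; exact h.2.1 k

/-- Restrictions to `G k` of a subprojective system decrease. -/
lemma res_antitone {φ : ∀ n, G n → ℂ} (hφ : φ ∈ subprojCone K ι) (k N : ℕ) :
    ConeLE (posTypeCone (K k)) (res ι k (N + 1) (φ (k + (N + 1)))) (res ι k N (φ (k + N))) :=
  res_mem_posTypeCone ι hι hK k N (hφ.2 (k + N))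

/-- The projective part of a subprojective system is the limit of its restrictions. -/
lemma exists_proj_limit {φ : ∀ n, G n → ℂ} (hφ : φ ∈ subprojCone K ι) :
    ∃ Φ ∈ projCone K ι, ∀ k,
      TendstoUniformly (fun N => res ι k N (φ (k + N))) (Φ k) atTop := by
  have h1 := fun k => exists_tendstoUniformly_of_decrements (K := K k)
    (h := fun N => res ι k N (φ (k + N)))
    (fun N => res_mem_posTypeCone ι hι hK k N (hφ.1 _)) (res_antitone hι hK hφ k)
  choose Φ hΦ hlim using h1
  refine ⟨Φ, ⟨hΦ, fun k => funext fun g => ?_⟩, hlim⟩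
  have h2 := (hlim (k + 1)).tendsto_at (ι k g)
  simp only [res_succ_apply] at h2
  exact tendsto_nhds_unique h2 ((tendsto_add_atTop_iff_nat 1).2 ((hlim k).tendsto_at g))

/-- With the successive differences as ψ, the partial sums telescope, and their error is that of the
restrictions of φ (k + N) as approximations of Φ k. -/
lemma exists_isDecomposition {φ : ∀ n, G n → ℂ} (hφ : φ ∈ subprojCone K ι) :
    ∃ Φ ψ, IsDecomposition K ι φ Φ ψ := by
  obtain ⟨Φ, hΦ, hlim⟩ := exists_proj_limit hι hK hφ
  refine ⟨Φ, fun k => φ k - res ι k 1 (φ (k + 1)), hΦ, hφ.2, fun k => ?_⟩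
  have hs : ∀ (N : ℕ) (g : G k),
      ∑ j ∈ Finset.range N, res ι k j (φ (k + j) - res ι (k + j) 1 (φ (k + j + 1))) g =
        φ k g - res ι k N (φ (k + N)) g := fun N g => by
    have := Finset.sum_range_sub' (fun j => res ι k j (φ (k + j)) g) N
    exact this
  rw [Metric.tendstoUniformly_iff]
  intro ε hε
  filter_upwards [Metric.tendstoUniformly_iff.1 (hlim k) ε hε] with N hN g
  have := hN g
  rw [dist_eq_norm] at this ⊢
  rw [hs, sub_add_eq_sub_sub, sub_right_comm, sub_sub_cancel, norm_sub_rev]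
  exact this

/-- The difference φ' - φ lies in Q and has its own decomposition; adding that of φ must give, by
uniqueness, that of φ'. -/
lemma coneLE_of_isDecomposition {φ Φ ψ φ' Φ' ψ' : ∀ n, G n → ℂ} (h : IsDecomposition K ι φ Φ ψ)
    (h' : IsDecomposition K ι φ' Φ' ψ') (hle : ConeLE (subprojCone K ι) φ φ') :
    ConeLE (projCone K ι) Φ Φ' ∧ ∀ k, ConeLE (posTypeCone (K k)) (ψ k) (ψ' k) := by
  obtain ⟨Φ'', ψ'', h''⟩ := exists_isDecomposition hι hK hle
  have h3 := h''.add h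
  rw [sub_add_cancel] at h3
  obtain ⟨e1, e2⟩ := h'.unique h3
  refine ⟨?_, fun k => ?_⟩
  · rw [ConeLE, e1, add_sub_cancel_right]; exact h''.1
  · rw [ConeLE, e2, Pi.add_apply, add_sub_cancel_right]; exact h''.2.1 k

/-- Data dominated by the components of a subprojective system come from a subprojective system. -/
lemma IsDecomposition.exists_of_le {φ' Φ' ψ' Φ ψ : ∀ n, G n → ℂ}
    (h : IsDecomposition K ι φ' Φ' ψ') (hΦ : Φ ∈ projCone K ι)
    (hψ : ∀ k, ψ k ∈ posTypeCone (K k))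
    (hle : ∀ k, ConeLE (posTypeCone (K k)) (ψ k) (ψ' k)) : ∃ φ, IsDecomposition K ι φ Φ ψ := by
  have h1 : ∀ k, ∃ f, TendstoUniformly
      (fun (N : ℕ) (g : G k) => Φ k g + ∑ j ∈ Finset.range N, res ι k j (ψ (k + j)) g) f atTop := by
    intro k
    have hre : ∀ j, 0 ≤ (res ι k j (ψ' (k + j)) 1).re := fun j =>
      (norm_nonneg _).trans ((res_mem_posTypeCone ι hι hK k j (h.2.1 _)).2.1.norm_le 1)
    -- At 1 the dominating series has nonnegative terms and a finite sum, which bounds the partial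
    -- sums of the dominated one.
    have hsum : ∀ N, ∑ j ∈ Finset.range N, (res ι k j (ψ' (k + j)) 1).re ≤
        (φ' k 1).re - (Φ' k 1).re := fun N => by
      have ht := (Complex.continuous_re.tendsto _).comp (h.tendsto k 1)
      have hm : Monotone fun N => (Φ' k 1 + ∑ j ∈ Finset.range N, res ι k j (ψ' (k + j)) 1).re :=
        monotone_nat_of_le_succ fun N => by
          rw [Finset.sum_range_succ]
          simp only [Complex.add_re]
          linarith [hre N]
      have := hm.ge_of_tendsto ht N
      simp only [Complex.add_re, Complex.re_sum] at this
      linarith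
    refine exists_tendstoUniformly_of_increments (K := K k)
      (B := (Φ k 1).re + ((φ' k 1).re - (Φ' k 1).re)) (fun N => ?_) fun N => ?_
    · have : ((fun g : G k => Φ k g + ∑ j ∈ Finset.range (N + 1), res ι k j (ψ (k + j)) g) -
          fun g => Φ k g + ∑ j ∈ Finset.range N, res ι k j (ψ (k + j)) g) =
          res ι k N (ψ (k + N)) := by
        funext g; simp [Finset.sum_range_succ]
      rw [this]
      exact res_mem_posTypeCone ι hι hK k N (hψ _)
    · rw [Complex.add_re, Complex.re_sum]
      refine add_le_add le_rfl (le_trans (Finset.sum_le_sum fun j _ => ?_) (hsum N))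
      have := (norm_nonneg _).trans
        ((res_mem_posTypeCone ι hι hK k j (hle (k + j))).2.1.norm_le 1)
      rw [res_sub, Pi.sub_apply, Complex.sub_re] at this
      linarith
  choose φ hφ using h1
  exact ⟨φ, hΦ, hψ, hφ⟩

variable (hinf : ∀ n, ∀ x ∈ posTypeCone (K n), ∀ y ∈ posTypeCone (K n),
  ∃ z, IsConeInf (posTypeCone (K n)) x y z)
include hinf

/-- The infimum of two projective systems is the projective part of the subprojective system of
their infima. -/
lemma exists_isConeInf_projCone {Φ₁ Φ₂ : ∀ n, G n → ℂ} (h₁ : Φ₁ ∈ projCone K ι)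
    (h₂ : Φ₂ ∈ projCone K ι) : ∃ Φ, IsConeInf (projCone K ι) Φ₁ Φ₂ Φ := by
  choose f hf using fun n => hinf n _ (h₁.1 n) _ (h₂.1 n)
  have hfQ : f ∈ subprojCone K ι := by
    refine ⟨fun n => (hf n).1, fun n => (hf n).2.2.2 _
      (res_mem_posTypeCone ι hι hK n 1 (hf (n + 1)).1) ?_ ?_⟩
    · rw [ConeLE, ← h₁.2 n]
      exact res_mem_posTypeCone ι hι hK n 1 (hf (n + 1)).2.1
    · rw [ConeLE, ← h₂.2 n]
      exact res_mem_posTypeCone ι hι hK n 1 (hf (n + 1)).2.2.1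
  obtain ⟨Φ, hΦ, hlim⟩ := exists_proj_limit hι hK hfQ
  have hres : ∀ X ∈ projCone K ι, ∀ k N, res ι k N (X (k + N)) = X k := fun X hX k N => by
    induction N with
    | zero => rfl
    | succ N ih => rw [← ih, ← hX.2 (k + N)]; rfl
  -- A difference of projective systems is compatible with restriction, so only membership at each
  -- level needs checking.
  have hsub : ∀ X ∈ projCone K ι, ∀ Y ∈ projCone K ι,
      (∀ k, ConeLE (posTypeCone (K k)) (X k) (Y k)) → ConeLE (projCone K ι) X Y :=
    fun X hX Y hY h => ⟨h, fun n => by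
      change res ι n 1 (Y (n + 1)) - res ι n 1 (X (n + 1)) = _
      rw [hX.2, hY.2]; rfl⟩
  have hconst : ∀ (k : ℕ) (X : G k → ℂ), TendstoUniformly (fun (_ : ℕ) => X) X atTop := fun k X => by
    rw [Metric.tendstoUniformly_iff]
    exact fun ε hε => Eventually.of_forall fun n x => by simpa using hε
  refine ⟨Φ, hΦ, hsub _ hΦ _ h₁ fun k => ?_, hsub _ hΦ _ h₂ fun k => ?_, fun X hX hX₁ hX₂ =>
    hsub _ hX _ hΦ fun k => ?_⟩
  · refine mem_posTypeCone_of_tendstoUniformly (fun N => ?_) ((hconst k (Φ₁ k)).sub (hlim k))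
    have := res_mem_posTypeCone ι hι hK k N (hf (k + N)).2.1
    rwa [res_sub, hres _ h₁] at this
  · refine mem_posTypeCone_of_tendstoUniformly (fun N => ?_) ((hconst k (Φ₂ k)).sub (hlim k))
    have := res_mem_posTypeCone ι hι hK k N (hf (k + N)).2.2.1
    rwa [res_sub, hres _ h₂] at this
  · refine mem_posTypeCone_of_tendstoUniformly (fun N => ?_) ((hlim k).sub (hconst k (X k)))
    have := res_mem_posTypeCone ι hι hK k N ((hf (k + N)).2.2.2 _ (hX.1 _) (hX₁.1 _) (hX₂.1 _))
    rwa [res_sub, hres _ hX] at this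

/-- Infima of subprojective systems are computed componentwise. -/
lemma exists_isConeInf_subprojCone {φ₁ φ₂ Φ₁ ψ₁ Φ₂ ψ₂ : ∀ n, G n → ℂ}
    (h₁ : IsDecomposition K ι φ₁ Φ₁ ψ₁) (h₂ : IsDecomposition K ι φ₂ Φ₂ ψ₂) :
    ∃ φ Φ ψ : ∀ n, G n → ℂ, IsConeInf (projCone K ι) Φ₁ Φ₂ Φ ∧
      (∀ n, IsConeInf (posTypeCone (K n)) (ψ₁ n) (ψ₂ n) (ψ n)) ∧
      IsDecomposition K ι φ Φ ψ ∧ IsConeInf (subprojCone K ι) φ₁ φ₂ φ := by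
  obtain ⟨Φ, hΦ⟩ := exists_isConeInf_projCone hι hK hinf h₁.1 h₂.1
  choose ψ hψ using fun n => hinf n _ (h₁.2.1 n) _ (h₂.2.1 n)
  obtain ⟨φ, h⟩ := h₁.exists_of_le hι hK hΦ.1 (fun k => (hψ k).1) fun k => (hψ k).2.1
  refine ⟨φ, Φ, ψ, hΦ, hψ, h, h.mem_subprojCone hι hK,
    (h₁.sub h hΦ.2.1 fun k => (hψ k).2.1).mem_subprojCone hι hK,
    (h₂.sub h hΦ.2.2.1 fun k => (hψ k).2.2.1).mem_subprojCone hι hK, fun w hw hw₁ hw₂ => ?_⟩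
  -- A common lower bound is compared component by component, then reassembled.
  obtain ⟨Φ', ψ', h'⟩ := exists_isDecomposition hι hK hw
  obtain ⟨a₁, b₁⟩ := coneLE_of_isDecomposition hι hK h' h₁ hw₁
  obtain ⟨a₂, b₂⟩ := coneLE_of_isDecomposition hι hK h' h₂ hw₂
  exact (h.sub h' (hΦ.2.2.2 _ h'.1 a₁ a₂) fun k =>
    (hψ k).2.2.2 _ (h'.2.1 k) (b₁ k) (b₂ k)).mem_subprojCone hι hK

/-- Suprema of subprojective systems are computed componentwise. -/
lemma exists_isConeSup_subprojCone {φ₁ φ₂ Φ₁ ψ₁ Φ₂ ψ₂ : ∀ n, G n → ℂ}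
    (h₁ : IsDecomposition K ι φ₁ Φ₁ ψ₁) (h₂ : IsDecomposition K ι φ₂ Φ₂ ψ₂) :
    ∃ φ Φ ψ : ∀ n, G n → ℂ, IsConeSup (projCone K ι) Φ₁ Φ₂ Φ ∧
      (∀ n, IsConeSup (posTypeCone (K n)) (ψ₁ n) (ψ₂ n) (ψ n)) ∧
      IsDecomposition K ι φ Φ ψ ∧ IsConeSup (subprojCone K ι) φ₁ φ₂ φ := by
  obtain ⟨φ, Φ, ψ, hΦ, hψ, h, hφ⟩ := exists_isConeInf_subprojCone hι hK hinf h₁ h₂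
  have sΦ := hΦ.isConeSup (fun x hx y hy => exists_isConeInf_projCone hι hK hinf hx hy) h₁.1 h₂.1
  have sψ := fun n => (hψ n).isConeSup (hinf n) (h₁.2.1 n) (h₂.2.1 n)
  refine ⟨φ₁ + φ₂ - φ, Φ₁ + Φ₂ - Φ, ψ₁ + ψ₂ - ψ, sΦ, sψ, (h₁.add h₂).sub h sΦ.1 fun k => (sψ k).1,
    hφ.isConeSup (fun x hx y hy => ?_) (h₁.mem_subprojCone hι hK) (h₂.mem_subprojCone hι hK)⟩
  obtain ⟨_, _, hx'⟩ := exists_isDecomposition hι hK hx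
  obtain ⟨_, _, hy'⟩ := exists_isDecomposition hι hK hy
  obtain ⟨z, _, _, _, _, _, hz⟩ := exists_isConeInf_subprojCone hι hK hinf hx' hy'
  exact ⟨z, hz⟩

end Systems

end Olshanski

theorem proposition9 {G : ℕ → Type*} [∀ n, Group (G n)] [∀ n, TopologicalSpace (G n)]
    [∀ n, IsTopologicalGroup (G n)] [∀ n, T2Space (G n)] [∀ n, LocallyCompactSpace (G n)]
    [∀ n, MeasurableSpace (G n)] [∀ n, BorelSpace (G n)]
    (K : ∀ n, Subgroup (G n)) (hGelfand : ∀ n, Olshanski.IsGelfandPair (K n))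
    (ι : ∀ n, G n →* G (n + 1)) (hι : ∀ n, Topology.IsClosedEmbedding (ι n))
    (hK : ∀ n, (K (n + 1)).comap (ι n) = K n) :
    Olshanski.IsLatticeCone (Olshanski.subprojCone K ι) ∧
    (∀ φ ∈ Olshanski.subprojCone K ι,
      ∃! p : (∀ n, G n → ℂ) × (∀ n, G n → ℂ), Olshanski.IsDecomposition K ι φ p.1 p.2) ∧
    (∀ φ₁ ∈ Olshanski.subprojCone K ι, ∀ φ₂ ∈ Olshanski.subprojCone K ι,
      ∀ Φ₁ ψ₁ Φ₂ ψ₂ : ∀ n, G n → ℂ,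
        Olshanski.IsDecomposition K ι φ₁ Φ₁ ψ₁ → Olshanski.IsDecomposition K ι φ₂ Φ₂ ψ₂ →
        (∃ φmin Φmin ψmin : ∀ n, G n → ℂ,
          Olshanski.IsConeInf (Olshanski.projCone K ι) Φ₁ Φ₂ Φmin ∧
          (∀ n, Olshanski.IsConeInf (Olshanski.posTypeCone (K n)) (ψ₁ n) (ψ₂ n) (ψmin n)) ∧
          Olshanski.IsDecomposition K ι φmin Φmin ψmin ∧
          Olshanski.IsConeInf (Olshanski.subprojCone K ι) φ₁ φ₂ φmin) ∧
        (∃ φmax Φmax ψmax : ∀ n, G n → ℂ,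
          Olshanski.IsConeSup (Olshanski.projCone K ι) Φ₁ Φ₂ Φmax ∧
          (∀ n, Olshanski.IsConeSup (Olshanski.posTypeCone (K n)) (ψ₁ n) (ψ₂ n) (ψmax n)) ∧
          Olshanski.IsDecomposition K ι φmax Φmax ψmax ∧
          Olshanski.IsConeSup (Olshanski.subprojCone K ι) φ₁ φ₂ φmax)) := by
  have hc : ∀ n, Continuous (ι n) := fun n => (hι n).continuous
  -- The Gelfand property enters through the existence of infima at each level.
  have hinf : ∀ n, ∀ x ∈ Olshanski.posTypeCone (K n), ∀ y ∈ Olshanski.posTypeCone (K n),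
      ∃ z, Olshanski.IsConeInf (Olshanski.posTypeCone (K n)) x y z :=
    fun n _ hx _ hy => (hGelfand n).exists_isConeInf hx hy
  refine ⟨fun x hx y hy => ?_, fun φ hφ => ?_, fun φ₁ _ φ₂ _ Φ₁ ψ₁ Φ₂ ψ₂ h₁ h₂ =>
    ⟨Olshanski.exists_isConeInf_subprojCone hc hK hinf h₁ h₂,
      Olshanski.exists_isConeSup_subprojCone hc hK hinf h₁ h₂⟩⟩
  · obtain ⟨_, _, hx'⟩ := Olshanski.exists_isDecomposition hc hK hx
    obtain ⟨_, _, hy'⟩ := Olshanski.exists_isDecomposition hc hK hy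
    obtain ⟨z, _, _, _, _, _, hz⟩ := Olshanski.exists_isConeInf_subprojCone hc hK hinf hx' hy'
    obtain ⟨w, _, _, _, _, _, hw⟩ := Olshanski.exists_isConeSup_subprojCone hc hK hinf hx' hy'
    exact ⟨⟨z, hz⟩, ⟨w, hw⟩⟩
  · obtain ⟨Φ, ψ, h⟩ := Olshanski.exists_isDecomposition hc hK hφ
    exact ⟨(Φ, ψ), h, fun p hp => Prod.ext (hp.unique h).1 (hp.unique h).2⟩
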